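/- **Setting.** Let $\mathcal E$ be a finite set of links and $T>0$. Let $R\in\mathbb R_{\ge 0}^{\mathcal E\times\mathcal E}$ be sub-stochastic (row sums at most $1$, at least one row sum $<1$; $R_{ji}$ is the fraction of the outflow of $j$ routed to $i$), and let $\delta_{ji}\ge 0$ be travel times. The external inflows $\lambda_i$ and capacities $c_i$ are non-negative, $T$-periodic and piecewise constant (on $[0,T)$: finitely many right-open pieces), and satisfy the stability condition: there is $\epsilon>0$ with $(I-R^{\top})\bar c>\bar\lambda+\epsilon\mathbf 1$ componentwise, where $\bar\lambda_i=\frac1T\int_0^T\lambda_i$ and $\bar c_i=\frac1T\int_0^Tc_i$. Fix any $\eta\in\mathbb R_{>0}^{\mathcal E}$. **Network dynamics.** Let $\mathcal E_i=\{j: R_{ji}>0,\ \delta_{ji}=0\}$, $\bar\delta=\max\{\delta_{ji}:R_{ji}>0\}$ (and $0$ if $R=0$), and $\tilde\lambda_i(t)=\lambda_i(t)+\sum_{j\notin\mathcal E_i}R_{ji}z_j(t-\delta_{ji})$. A trajectory is a pair $(x,z)$ with $x(t)\ge 0$ for $t\ge0$ and $z$ locally integrable on $[-\bar\delta,\infty)$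 with non-negative history on $[-\bar\delta,0)$, such that for all $t\ge 0$ $$x_i(t)=x_i(0)+\int_0^t\Big(\tilde\lambda_i(s)+\sum_{j\in\mathcal E_i}R_{ji}z_j(s)-z_i(s)\Big)ds,\qquad i\in\mathcal E,$$ and $z(t)$ maximizes $\eta^{\top}\zeta$ over the $\zeta\in\mathbb R^{\mathcal E}$ with $\zeta_i\le c_i(t)$ for all $i$ and $\zeta_i\le\tilde\lambda_i(t)+\sum_{j\in\mathcal E_i}R_{ji}\zeta_j$ for all $i$ with $x_i(t)=0$. A $T$-periodic orbit is a trajectory, given on all of $\mathbb R$, with $x$ and $z$ both $T$-periodic. **Algorithm 1** (one link, $T$-periodic inflow $y$ and capacity $c$). The positive (negative) sets are the maximal contiguous subsets of $[0,T)$ of non-zero size on which $y>c$ (resp. $y<c$). Let $\underline w^1<\dots<\underline w^M$ be the left endpoints of the positive sets and $\bar b^p$ the right endpoints of the negative sets. If there is no positive set, put $x(0)=0$. Otherwise put $r_1=1$ and let $r_j$ be the least $\ell\in\{r_{j-1}+1,\dots,M\}$ for which there is $p$ with $\bar b^p\in(\underline w^{\ell-1},\underline w^{\ell}]$ and $$\int_{\underline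 w^{r_{j-1}}}^{\bar b^p}y\le\int_{\underline w^{r_{j-1}}}^{\bar b^p}c\ \text{ if }\bar b^p<\underline w^{\ell},\qquad \int_{\underline w^{r_{j-1}}}^{\bar b^p}y<\int_{\underline w^{r_{j-1}}}^{\bar b^p}c\ \text{ if }\bar b^p=\underline w^{\ell};$$ stop at $r_m$ when no such $\ell$ exists, put $\alpha=\underline w^{r_m}$ and $x(0)=\big[\int_\alpha^T y-\int_\alpha^T c\big]^+$. Then simulate the isolated link over one period: $x\ge0$ and $x(t)=x(0)+\int_0^t(y-z)\,ds$ for $t\in[0,T]$, where $z(t)=c(t)$ if $x(t)>0$ and $z(t)=\min\{c(t),y(t)\}$ if $x(t)=0$. The output $(x,z)$ is this pair, regarded as $T$-periodic functions. **Algorithm 2** (network, run without termination). Start from $y^{(1)}_i=\lambda_i$. For $k\ge1$ let $(x_i^{(k)},z_i^{(k)})$ be the output of Algorithm 1 for $(y_i^{(k)},c_i)$, $i\in\mathcal E$, and let $y_i^{(k+1)}(t)=\lambda_i(t)+\sum_{j}R_{ji}z_j^{(k)}(t-\delta_{ji})$. **Claim.** Algorithm 2 is well defined: there is exactly one sequence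 of iterates $(x^{(k)},z^{(k)})_{k\ge1}$ as above. Moreover: 1. (Boundedness) There is $B$ with $0\le x_i^{(k)}(t)\le B$, and $0\le z_i^{(k)}(t)\le c_i(t)$, for all $k,i,t$. 2. (Monotonicity, uniformly in time) $x_i^{(k)}(t)\le x_i^{(k+1)}(t)$ and $z_i^{(k)}(t)\le z_i^{(k+1)}(t)$ for all $k,i,t$. 3. (Convergence) There are $x^*,z^*$ such that $x_i^{(k)}\to x_i^*$ uniformly in $t$, $z_i^{(k)}(t)\to z_i^*(t)$ for every $t$, and $\int_0^T|z_i^{(k)}-z_i^*|\,dt\to0$, for every $i$. 4. (Limit) $(x^*,z^*)$ is a $T$-periodic orbit of the network dynamics, it is the only one, and it is globally attractive: for every trajectory $(x,z)$, as $t\to\infty$, $x_i(t)-x_i^*(t)\to0$ for all $i$ and $\sum_{i,j}R_{ji}\int_{t-\delta_{ji}}^t|z_j(s)-z_j^*(s)|\,ds\to0$. -/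

import Mathlib

open Set Filter Topology

noncomputable section

namespace TrafficNetwork

/-! ## Piecewise constant functions, periods, averages -/

/-- `f` is piecewise constant on one period: `[0, T)` is partitioned into finitely many
contiguous right-open intervals on each of which `f` is constant. -/
def PiecewiseConstantOn (T : ℝ) (f : ℝ → ℝ) : Prop :=
  ∃ (n : ℕ) (t : Fin (n + 1) → ℝ), StrictMono t ∧ t 0 = 0 ∧ t (Fin.last n) = T ∧
    ∀ k : Fin n, ∀ s ∈ Ico (t k.castSucc) (t k.succ), f s = f (t k.castSucc)

/-- The average of `f` over one period. -/
def average (T : ℝ) (f : ℝ → ℝ) : ℝ := (1 / T) * ∫ t in (0 : ℝ)..T, f t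

section Network

variable {E : Type*} [Fintype E]

/-- `R` is sub-stochastic: `R j i` is the fraction of the outflow of link `j` routed to link `i`. -/
structure IsSubstochastic (R : Matrix E E ℝ) : Prop where
  nonneg : ∀ j i, 0 ≤ R j i
  row_sum_le : ∀ j, ∑ i, R j i ≤ 1
  exists_row_sum_lt : ∃ j, ∑ i, R j i < 1

/-- The stability condition `(I - Rᵀ) (average of c) > (average of lam) + ε`, componentwise. -/
def StabilityCondition (T : ℝ) (R : Matrix E E ℝ) (lam c : E → ℝ → ℝ) : Prop :=
  ∃ ε : ℝ, 0 < ε ∧ ∀ i,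
    average T (lam i) + ε < average T (c i) - ∑ j, R j i * average T (c j)

/-! ## Network dynamics -/

/-- Links upstream of `i` with zero travel time to `i`. -/
def instantUpstream (R : Matrix E E ℝ) (δ : E → E → ℝ) (i : E) : Finset E :=
  Finset.univ.filter fun j => 0 < R j i ∧ δ j i = 0

/-- Net inflow to `i` at time `t` from outside and from upstream vehicles that were travelling. -/
def delayedInflow (R : Matrix E E ℝ) (δ : E → E → ℝ) (lam z : E → ℝ → ℝ) (i : E) (t : ℝ) : ℝ :=
  lam i t + ∑ j ∈ Finset.univ.filter (fun j => ¬ (0 < R j i ∧ δ j i = 0)),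
    R j i * z j (t - δ j i)

/-- Feasible set of the linear program for the outflows, when the queue lengths are `q`, the
capacities are `cap` and the delayed inflows are `inflow`. -/
def FeasibleOutflows (R : Matrix E E ℝ) (δ : E → E → ℝ) (q cap inflow : E → ℝ) : Set (E → ℝ) :=
  {ζ | (∀ i, ζ i ≤ cap i) ∧
    ∀ i, q i = 0 → ζ i ≤ inflow i + ∑ j ∈ instantUpstream R δ i, R j i * ζ j}

/-- `ζ` solves the linear program "maximize `ηᵀ ζ` over the feasible outflows". -/
def IsOptimalOutflow (R : Matrix E E ℝ) (δ : E → E → ℝ) (η q cap inflow ζ : E → ℝ) : Prop :=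
  ζ ∈ FeasibleOutflows R δ q cap inflow ∧
    ∀ ζ' ∈ FeasibleOutflows R δ q cap inflow, ∑ i, η i * ζ' i ≤ ∑ i, η i * ζ i

/-- The maximal travel time over pairs of links with positive routing. -/
def maxDelay (R : Matrix E E ℝ) (δ : E → E → ℝ) : ℝ :=
  ⨆ p : E × E, if 0 < R p.1 p.2 then δ p.1 p.2 else 0

/-- `(x, z)` is a trajectory of the network dynamics for `t ≥ 0`. The history of departures is the
restriction of `z` to `[-maxDelay, 0)`; the differential equation is in integrated form. -/
structure IsTrajectory (R : Matrix E E ℝ) (δ : E → E → ℝ) (lam c : E → ℝ → ℝ) (η : E → ℝ)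
    (x z : E → ℝ → ℝ) : Prop where
  queue_nonneg : ∀ i, ∀ t, 0 ≤ t → 0 ≤ x i t
  history_nonneg : ∀ i, ∀ t, -maxDelay R δ ≤ t → t < 0 → 0 ≤ z i t
  integrable : ∀ i, ∀ t, 0 ≤ t →
    IntervalIntegrable (z i) MeasureTheory.volume (-maxDelay R δ) t
  outflow : ∀ t, 0 ≤ t →
    IsOptimalOutflow R δ η (fun i => x i t) (fun i => c i t)
      (fun i => delayedInflow R δ lam z i t) (fun i => z i t)
  queue : ∀ i, ∀ t, 0 ≤ t → x i t = x i 0 + ∫ s in (0 : ℝ)..t,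
    (delayedInflow R δ lam z i s + ∑ j ∈ instantUpstream R δ i, R j i * z j s - z i s)

/-- `(x, z)` is a `T`-periodic orbit of the network dynamics. -/
structure IsPeriodicOrbit (T : ℝ) (R : Matrix E E ℝ) (δ : E → E → ℝ) (lam c : E → ℝ → ℝ)
    (η : E → ℝ) (x z : E → ℝ → ℝ) : Prop where
  trajectory : IsTrajectory R δ lam c η x z
  queue_periodic : ∀ i, Function.Periodic (x i) T
  outflow_periodic : ∀ i, Function.Periodic (z i) T

/-- The distance at time `t`, in the norm that counts vehicles in transit, between the departure
histories of two trajectories. -/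
def historyDist (R : Matrix E E ℝ) (δ : E → E → ℝ) (z z' : E → ℝ → ℝ) (t : ℝ) : ℝ :=
  ∑ i, ∑ j, R j i * ∫ s in (t - δ j i)..t, |z j s - z' j s|

/-- `(x, z)` attracts every trajectory of the network dynamics. -/
def IsGloballyAttractive (R : Matrix E E ℝ) (δ : E → E → ℝ) (lam c : E → ℝ → ℝ)
    (η : E → ℝ) (x z : E → ℝ → ℝ) : Prop :=
  ∀ x' z' : E → ℝ → ℝ, IsTrajectory R δ lam c η x' z' →
    (∀ i, Tendsto (fun t => x' i t - x i t) atTop (𝓝 0)) ∧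
    Tendsto (fun t => historyDist R δ z' z t) atTop (𝓝 0)

end Network

/-! ## The single-link algorithm, with inflow `y` and capacity `c` -/

/-- Maximal contiguous subsets of non-zero size of `{t ∈ [0, T) | f t < g t}`. With `(f, g) = (c, y)`
these are the positive sets, with `(f, g) = (y, c)` the negative sets. -/
def IsMaximalInterval (T : ℝ) (f g : ℝ → ℝ) (S : Set ℝ) : Prop :=
  Maximal (fun A : Set ℝ => A.OrdConnected ∧ A ⊆ {t | t ∈ Ico 0 T ∧ f t < g t}) S ∧ S.Nontrivial

/-- Left endpoints of the positive sets. -/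
def positiveLeft (T : ℝ) (y c : ℝ → ℝ) : Set ℝ := {w | ∃ S, IsMaximalInterval T c y S ∧ w = sInf S}

/-- Right endpoints of the negative sets. -/
def negativeRight (T : ℝ) (y c : ℝ → ℝ) : Set ℝ := {b | ∃ S, IsMaximalInterval T y c S ∧ b = sSup S}

/-- The indices `ind ∈ {r + 1, …, M}` of positive sets before which, and after the previous positive
set has started, there is a negative set at the end of which the queue that starts empty at `w r`
has been emptied (strictly before `w ind`, or with strict inequality). -/
def candidates (T : ℝ) (y c : ℝ → ℝ) (M : ℕ) (w : ℕ → ℝ) (r : ℕ) : Set ℕ :=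
  {ind | r + 1 ≤ ind ∧ ind ≤ M ∧ ∃ b ∈ negativeRight T y c, b ∈ Ioc (w (ind - 1)) (w ind) ∧
    ((b < w ind ∧ (∫ t in (w r)..b, y t) ≤ (∫ t in (w r)..b, c t)) ∨
      (b = w ind ∧ (∫ t in (w r)..b, y t) < (∫ t in (w r)..b, c t)))}

/-- `α = w (r m)`, where `w 1 < … < w M` are the left endpoints of the positive sets, `r 1 = 1`,
`r j` is the least candidate after `r (j - 1)` for `2 ≤ j ≤ m`, and `r m` has no candidate. -/
def IsLastTransition (T : ℝ) (y c : ℝ → ℝ) (α : ℝ) : Prop :=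
  ∃ (M : ℕ) (w : ℕ → ℝ) (m : ℕ) (r : ℕ → ℕ),
    1 ≤ M ∧ StrictMonoOn w (Icc 1 M) ∧ w '' Icc 1 M = positiveLeft T y c ∧
    1 ≤ m ∧ r 1 = 1 ∧
    (∀ j ∈ Icc 2 m, IsLeast (candidates T y c M w (r (j - 1))) (r j)) ∧
    candidates T y c M w (r m) = ∅ ∧ α = w (r m)

/-- The initial queue length computed by the algorithm: zero in the trivial case without positive
sets, and `[Y(α, T) - C(α, T)]⁺` otherwise. -/
def IsInitialQueue (T : ℝ) (y c : ℝ → ℝ) (q : ℝ) : Prop :=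
  (positiveLeft T y c = ∅ ∧ q = 0) ∨
    ∃ α, IsLastTransition T y c α ∧ q = max ((∫ t in α..T, y t) - ∫ t in α..T, c t) 0

/-- Outflow of a link with queue length `q`, inflow `y` and capacity `c`. -/
def linkOutflow (q y c : ℝ) : ℝ := if 0 < q then c else min c y

/-- `(x, z)` is the output of the single-link algorithm for inflow `y` and capacity `c`: the queue
dynamics of the isolated link is simulated over one period from the computed initial queue length,
and the result is read as a pair of `T`-periodic functions. -/
structure IsSingleLinkOutput (T : ℝ) (y c x z : ℝ → ℝ) : Prop where
  queue_periodic : Function.Periodic x T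
  outflow_periodic : Function.Periodic z T
  initial : IsInitialQueue T y c (x 0)
  queue_nonneg : ∀ t ∈ Icc 0 T, 0 ≤ x t
  integrable : IntervalIntegrable z MeasureTheory.volume 0 T
  outflow : ∀ t ∈ Icc 0 T, z t = linkOutflow (x t) (y t) (c t)
  queue : ∀ t ∈ Icc 0 T, x t = x 0 + ∫ s in (0 : ℝ)..t, (y s - z s)

/-! ## The network algorithm -/

section Algorithm

variable {E : Type*} [Fintype E]

/-- Cumulative inflow into link `i` when the outflows are `z`. -/
def inflow (R : Matrix E E ℝ) (δ : E → E → ℝ) (lam z : E → ℝ → ℝ) (i : E) (t : ℝ) : ℝ :=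
  lam i t + ∑ j, R j i * z j (t - δ j i)

/-- `(x k, z k)`, `k = 0, 1, …`, are the iterates of the network algorithm (the first iterate has
index `0`). -/
structure IsAlgorithmRun (T : ℝ) (R : Matrix E E ℝ) (δ : E → E → ℝ) (lam c : E → ℝ → ℝ)
    (x z : ℕ → E → ℝ → ℝ) : Prop where
  first : ∀ i, IsSingleLinkOutput T (lam i) (c i) (x 0 i) (z 0 i)
  next : ∀ k i, IsSingleLinkOutput T (inflow R δ lam (z k) i) (c i) (x (k + 1) i) (z (k + 1) i)

end Algorithm

end TrafficNetwork

end

/-! Single link. For a periodic net inflow rate `u = y - c` with nonpositive mean, the periodic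
queue has the reflection formula Q(t) = max over s ≤ t of the integral of u over [s, t], where s in
[t - T, t] suffices (`periodicQueue`). Q satisfies the queue equation, and a simulated queue that
starts from Q(0) must coincide with it (`queue_eq_periodicQueue`). The transitions of the algorithm
move greedily to new minima of the cumulative net inflow, so the last transition α is either an
optimal start s for t = T or no worse than the empty window; hence the computed initial queue is
Q(T) = Q(0) (`IsInitialQueue.eq_periodicQueue`). This needs finitely many positive and negative
sets, so the class of step functions (`IsStep`) is shown to be closed under shifts, sums and the
passage from inflow to outflow.

Iterates. The formula for Q is monotone in the inflow and Lipschitz from L¹ over a period to the sup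
norm. Starting from λ, the inflows therefore increase, while stability keeps their mean below that
of the capacity. Outflows converge pointwise and, by domination, in L¹; queues then converge
uniformly. The law `linkOutflow` jumps at an empty queue, but it survives the limit because the
queues increase: an empty limit queue was empty all along (`outflowLimit_eq`).

Network. The stability condition makes the vector of mean capacities a positive vector that the
transposed routing matrix strictly contracts, which gives a maximum principle
(`IsContractionWeight.nonpos_of_le_sum`). By this principle the linear program has as its only
solution the fixed point of the link outflow law (`isOptimalOutflow_iff`), so trajectories are
coupled copies of the single-link dynamics.

Attraction. For two trajectories, |x - x'| changes at rate at most |y - y'| - |z - z'| on each link.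
Summed through the contraction, this bounds the integral of |z - z'| over all positive times, so x -
x' has a limit l. If l ≠ 0, then one of the two links is eventually never empty and discharges at
capacity over whole periods. For the limit orbit this contradicts its mean outflow being below
capacity; for the other trajectory it keeps the integral of |z - z'| over a period at a positive
constant. So l = 0. Uniqueness follows: a periodic difference of queues that tends to 0 vanishes,
and the maximum principle, applied to suprema over time, then identifies the outflows at every
instant. -/

namespace TrafficNetwork

open MeasureTheory

/-! ## The periodic queue of an isolated link -/

section PeriodicQueue

/-- The largest net inflow that a link with net inflow rate `u` accumulates up to time `t` over a
window of length at most one period. -/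
noncomputable def periodicQueue (T : ℝ) (u : ℝ → ℝ) (t : ℝ) : ℝ :=
  sSup ((fun s => ∫ r in s..t, u r) '' Icc (t - T) t)

variable {T : ℝ} {u v : ℝ → ℝ}

theorem continuous_integral_left (hi : ∀ a b, IntervalIntegrable u volume a b) (t : ℝ) :
    Continuous fun s => ∫ r in s..t, u r := by
  have h := (intervalIntegral.continuous_primitive hi t).neg
  exact h.congr fun s => (intervalIntegral.integral_symm t s).symm

theorem isCompact_windowIntegrals (hi : ∀ a b, IntervalIntegrable u volume a b) (t : ℝ) :
    IsCompact ((fun s => ∫ r in s..t, u r) '' Icc (t - T) t) :=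
  isCompact_Icc.image (continuous_integral_left hi t)

theorem exists_periodicQueue_eq (hT : 0 < T) (hi : ∀ a b, IntervalIntegrable u volume a b)
    (t : ℝ) : ∃ s ∈ Icc (t - T) t, periodicQueue T u t = ∫ r in s..t, u r := by
  have hne : ((fun s => ∫ r in s..t, u r) '' Icc (t - T) t).Nonempty :=
    (nonempty_Icc.2 (by linarith)).image _
  obtain ⟨s, hs, h⟩ := (isCompact_windowIntegrals (T := T) hi t).sSup_mem hne
  exact ⟨s, hs, h.symm⟩

theorem integral_le_periodicQueue_of_mem (hi : ∀ a b, IntervalIntegrable u volume a b)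
    {s t : ℝ} (hs : s ∈ Icc (t - T) t) : ∫ r in s..t, u r ≤ periodicQueue T u t :=
  le_csSup (isCompact_windowIntegrals hi t).bddAbove (mem_image_of_mem _ hs)

theorem periodicQueue_nonneg (hT : 0 < T) (hi : ∀ a b, IntervalIntegrable u volume a b) (t : ℝ) :
    0 ≤ periodicQueue T u t := by
  have h := integral_le_periodicQueue_of_mem (T := T) hi (s := t) (t := t) ⟨by linarith, le_rfl⟩
  simpa using h

/-- Removing a full period from the start of a window does not lower its integral, because the mean
of `u` is nonpositive. Induction on the number of periods brings any window down to length at most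
`T`. -/
theorem integral_le_periodicQueue (hT : 0 < T) (hi : ∀ a b, IntervalIntegrable u volume a b)
    (hp : Function.Periodic u T) (hneg : ∫ r in (0 : ℝ)..T, u r ≤ 0) {s t : ℝ} (hst : s ≤ t) :
    ∫ r in s..t, u r ≤ periodicQueue T u t := by
  have key : ∀ n : ℕ, ∀ s, t - n * T ≤ s → s ≤ t →
      ∫ r in s..t, u r ≤ periodicQueue T u t := by
    intro n
    induction n with
    | zero =>
      intro s h1 h2
      have : s = t := le_antisymm h2 (by simpa using h1)
      subst this
      exact integral_le_periodicQueue_of_mem hi ⟨by linarith, le_rfl⟩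
    | succ n ih =>
      intro s h1 h2
      rcases le_or_gt (t - T) s with h | h
      · exact integral_le_periodicQueue_of_mem hi ⟨h, h2⟩
      · have h3 := ih (s + T) (by push_cast at h1; linarith) (by linarith)
        have h4 := intervalIntegral.integral_add_adjacent_intervals (hi s (s + T)) (hi (s + T) t)
        have h5 : ∫ r in s..s + T, u r = ∫ r in (0 : ℝ)..T, u r := by
          simpa using hp.intervalIntegral_add_eq s 0
        linarith
  obtain ⟨n, hn⟩ := exists_nat_ge ((t - s) / T)
  exact key n s (by rw [div_le_iff₀ hT] at hn; linarith) hst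

theorem periodicQueue_periodic (hp : Function.Periodic u T) :
    Function.Periodic (periodicQueue T u) T := by
  intro t
  unfold periodicQueue
  congr 1
  have key : ∀ s, ∫ r in s + T..t + T, u r = ∫ r in s..t, u r := by
    intro s
    rw [← intervalIntegral.integral_comp_add_right]
    exact intervalIntegral.integral_congr fun r _ => hp r
  ext q
  constructor
  · rintro ⟨s, hs, rfl⟩
    refine ⟨s - T, ⟨by linarith [hs.1], by linarith [hs.2]⟩, ?_⟩
    have := key (s - T)
    simpa using this.symm
  · rintro ⟨s, hs, rfl⟩
    exact ⟨s + T, ⟨by linarith [hs.1], by linarith [hs.2]⟩, key s⟩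

theorem periodicQueue_mono (hT : 0 < T) (hu : ∀ a b, IntervalIntegrable u volume a b)
    (hv : ∀ a b, IntervalIntegrable v volume a b) (huv : ∀ t, u t ≤ v t) (t : ℝ) :
    periodicQueue T u t ≤ periodicQueue T v t := by
  obtain ⟨s, hs, h⟩ := exists_periodicQueue_eq hT hu t
  rw [h]
  exact (intervalIntegral.integral_mono_on hs.2 (hu s t) (hv s t) fun r _ => huv r).trans
    (integral_le_periodicQueue_of_mem hv hs)

/-- The optimal window for `s`, prolonged to `t`, competes in the supremum at `t`; it may exceed one
period, hence the sign condition. -/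
theorem periodicQueue_add_integral_le (hT : 0 < T) (hi : ∀ a b, IntervalIntegrable u volume a b)
    (hp : Function.Periodic u T) (hneg : ∫ r in (0 : ℝ)..T, u r ≤ 0) {s t : ℝ} (hst : s ≤ t) :
    periodicQueue T u s + ∫ r in s..t, u r ≤ periodicQueue T u t := by
  obtain ⟨q, hq, h⟩ := exists_periodicQueue_eq hT hi s
  rw [h, intervalIntegral.integral_add_adjacent_intervals (hi q s) (hi s t)]
  exact integral_le_periodicQueue hT hi hp hneg (hq.2.trans hst)

/-- The queue is zero at the start `q` of an optimal window for `t`, since otherwise the window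
could be improved by prolonging it backwards. Positivity on `(s, t]` thus forces `q ≤ s`, and the
window splits at `s`. -/
theorem periodicQueue_eq_of_pos (hT : 0 < T) (hi : ∀ a b, IntervalIntegrable u volume a b)
    (hp : Function.Periodic u T) (hneg : ∫ r in (0 : ℝ)..T, u r ≤ 0) {s t : ℝ} (hst : s ≤ t)
    (hpos : ∀ r ∈ Ioc s t, 0 < periodicQueue T u r) :
    periodicQueue T u t = periodicQueue T u s + ∫ r in s..t, u r := by
  refine le_antisymm ?_ (periodicQueue_add_integral_le hT hi hp hneg hst)
  obtain ⟨q, hq, h⟩ := exists_periodicQueue_eq hT hi t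
  rcases le_or_gt q s with hqs | hqs
  · rw [h, ← intervalIntegral.integral_add_adjacent_intervals (hi q s) (hi s t)]
    gcongr
    exact integral_le_periodicQueue hT hi hp hneg hqs
  · have h1 := periodicQueue_add_integral_le hT hi hp hneg hq.2
    have h2 := hpos q ⟨hqs, hq.2⟩
    linarith

theorem periodicQueue_sub_le (hT : 0 < T) (hi : ∀ a b, IntervalIntegrable u volume a b)
    (hp : Function.Periodic u T) (hneg : ∫ r in (0 : ℝ)..T, u r ≤ 0) {s t : ℝ} (hst : s ≤ t) :
    |periodicQueue T u t - periodicQueue T u s| ≤ ∫ r in s..t, |u r| := by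
  have habs : ∀ {q t : ℝ}, q ≤ t → |∫ r in q..t, u r| ≤ ∫ r in q..t, |u r| := fun h =>
    intervalIntegral.abs_integral_le_integral_abs h
  rw [abs_le]
  constructor
  · have h1 := periodicQueue_add_integral_le hT hi hp hneg hst
    have h2 := (abs_le.1 (habs hst)).1
    linarith
  · obtain ⟨q, hq, h⟩ := exists_periodicQueue_eq hT hi t
    rcases le_or_gt q s with hqs | hqs
    · have h1 := intervalIntegral.integral_add_adjacent_intervals (hi q s) (hi s t)
      have h2 := integral_le_periodicQueue hT hi hp hneg hqs
      have h3 := (abs_le.1 (habs hst)).2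
      linarith
    · have h1 := intervalIntegral.integral_add_adjacent_intervals (hi s q).abs (hi q t).abs
      have h2 := (abs_le.1 (habs hq.2)).2
      have h3 : 0 ≤ ∫ r in s..q, |u r| :=
        intervalIntegral.integral_nonneg hqs.le fun r _ => abs_nonneg _
      have h4 := periodicQueue_nonneg hT hi s
      linarith

theorem continuous_periodicQueue (hT : 0 < T) (hi : ∀ a b, IntervalIntegrable u volume a b)
    (hp : Function.Periodic u T) (hneg : ∫ r in (0 : ℝ)..T, u r ≤ 0) :
    Continuous (periodicQueue T u) := by
  have hc : Continuous fun t => ∫ r in (0 : ℝ)..t, |u r| :=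
    intervalIntegral.continuous_primitive (fun a b => (hi a b).abs) 0
  rw [continuous_iff_continuousAt]
  intro t
  have h0 : Tendsto (fun s => abs ((∫ r in (0 : ℝ)..s, |u r|) - ∫ r in (0 : ℝ)..t, |u r|))
      (𝓝 t) (𝓝 0) := by
    have := ((hc.tendsto t).sub_const (∫ r in (0 : ℝ)..t, |u r|)).abs
    simpa using this
  rw [ContinuousAt, tendsto_iff_dist_tendsto_zero]
  refine squeeze_zero (fun _ => dist_nonneg) (fun s => ?_) h0
  rw [Real.dist_eq, intervalIntegral.integral_interval_sub_left (hi 0 s).abs (hi 0 t).abs]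
  rcases le_total s t with h | h
  · rw [abs_sub_comm, intervalIntegral.integral_symm, abs_neg]
    exact (periodicQueue_sub_le hT hi hp hneg h).trans (le_abs_self _)
  · exact (periodicQueue_sub_le hT hi hp hneg h).trans (le_abs_self _)

/-- The optimal window for one rate is a competitor for the other, and it fits into one period. The
bound does not depend on `t`; it is what turns L¹ convergence of inflows into uniform convergence of
queues. -/
theorem abs_periodicQueue_sub_le (hT : 0 < T) (hu : ∀ a b, IntervalIntegrable u volume a b)
    (hv : ∀ a b, IntervalIntegrable v volume a b) (hup : Function.Periodic u T)
    (hvp : Function.Periodic v T) (t : ℝ) :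
    |periodicQueue T u t - periodicQueue T v t| ≤ ∫ r in (0 : ℝ)..T, |u r - v r| := by
  have key : ∀ {u v : ℝ → ℝ}, (∀ a b, IntervalIntegrable u volume a b) →
      (∀ a b, IntervalIntegrable v volume a b) → Function.Periodic u T →
      Function.Periodic v T →
      periodicQueue T u t - periodicQueue T v t ≤ ∫ r in (0 : ℝ)..T, |u r - v r| := by
    intro u v hu hv hup hvp
    obtain ⟨s, hs, h⟩ := exists_periodicQueue_eq hT hu t
    have h1 := integral_le_periodicQueue_of_mem hv hs
    have hi : ∀ a b, IntervalIntegrable (fun r => |u r - v r|) volume a b :=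
      fun a b => ((hu a b).sub (hv a b)).abs
    have h2 : (∫ r in s..t, u r) - ∫ r in s..t, v r ≤ ∫ r in s..t, |u r - v r| := by
      rw [← intervalIntegral.integral_sub (hu s t) (hv s t)]
      exact intervalIntegral.integral_mono_on hs.2 ((hu s t).sub (hv s t)) (hi s t)
        fun r _ => le_abs_self _
    have h3 : ∫ r in s..t, |u r - v r| ≤ ∫ r in (t - T)..t, |u r - v r| := by
      rw [← intervalIntegral.integral_add_adjacent_intervals (hi (t - T) s) (hi s t)]
      have : 0 ≤ ∫ r in (t - T)..s, |u r - v r| :=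
        intervalIntegral.integral_nonneg hs.1 fun r _ => abs_nonneg _
      linarith
    have hper : Function.Periodic (fun r => |u r - v r|) T := fun r => by
      simp only [hup r, hvp r]
    have h4 := hper.intervalIntegral_add_eq (t - T) 0
    simp only [sub_add_cancel, zero_add] at h4
    linarith
  rw [abs_le]
  constructor
  · have := key hv hu hvp hup
    simp only [abs_sub_comm (v _)] at this
    linarith
  · exact key hu hv hup hvp

end PeriodicQueue

/-- If a continuous function is nonpositive at `a` and positive at `b`, then there is a last
nonpositive point before `b`. -/
theorem exists_last_nonpos {f : ℝ → ℝ} {a b : ℝ} (hab : a ≤ b) (hf : ContinuousOn f (Icc a b))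
    (ha : f a ≤ 0) (hb : 0 < f b) : ∃ s ∈ Ico a b, f s ≤ 0 ∧ ∀ r ∈ Ioc s b, 0 < f r := by
  have hcl : IsCompact {s ∈ Icc a b | f s ≤ 0} :=
    isCompact_Icc.of_isClosed_subset
      (hf.preimage_isClosed_of_isClosed isClosed_Icc isClosed_Iic) fun s hs => hs.1
  obtain ⟨s, hs, hmax⟩ := hcl.exists_isGreatest ⟨a, left_mem_Icc.2 hab, ha⟩
  refine ⟨s, ⟨hs.1.1, lt_of_le_of_ne hs.1.2 ?_⟩, hs.2, fun r hr => ?_⟩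
  · rintro rfl
    exact absurd hs.2 (not_le.2 hb)
  · by_contra! h
    exact absurd (hmax ⟨⟨hs.1.1.trans hr.1.le, hr.2⟩, h⟩) (not_le.2 hr.1)

/-! ### Elementary properties of the link outflow -/

theorem linkOutflow_le {q y c : ℝ} : linkOutflow q y c ≤ c := by
  unfold linkOutflow
  split_ifs
  · exact le_rfl
  · exact min_le_left _ _

theorem linkOutflow_nonneg {q y c : ℝ} (hy : 0 ≤ y) (hc : 0 ≤ c) : 0 ≤ linkOutflow q y c := by
  unfold linkOutflow
  split_ifs
  · exact hc
  · exact le_min hc hy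

/-- The jump at an empty queue goes upwards, from `min c y` to `c`, so the discontinuity does not
spoil monotonicity. -/
theorem linkOutflow_mono {q q' y y' c : ℝ} (hq : q ≤ q') (hy : y ≤ y') :
    linkOutflow q y c ≤ linkOutflow q' y' c := by
  unfold linkOutflow
  split_ifs with h1 h2 h2
  · exact le_rfl
  · exact absurd (h1.trans_le hq) h2
  · exact min_le_left _ _
  · exact min_le_min le_rfl hy

theorem linkOutflow_of_pos {q y c : ℝ} (hq : 0 < q) : linkOutflow q y c = c := if_pos hq

theorem linkOutflow_of_nonpos {q y c : ℝ} (hq : q ≤ 0) : linkOutflow q y c = min c y :=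
  if_neg (not_lt.2 hq)

/-- The queue of an isolated link is the periodic queue once it starts from it. -/
theorem queue_eq_periodicQueue {T : ℝ} (hT : 0 < T) {y c x z : ℝ → ℝ}
    (hy : ∀ a b, IntervalIntegrable y volume a b) (hc : ∀ a b, IntervalIntegrable c volume a b)
    (hyp : Function.Periodic y T) (hcp : Function.Periodic c T)
    (hneg : ∫ r in (0 : ℝ)..T, (y r - c r) ≤ 0)
    (hx0 : x 0 = periodicQueue T (fun r => y r - c r) 0)
    (hxn : ∀ t ∈ Icc 0 T, 0 ≤ x t) (hz : IntervalIntegrable z volume 0 T)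
    (hzo : ∀ t ∈ Icc 0 T, z t = linkOutflow (x t) (y t) (c t))
    (hq : ∀ t ∈ Icc 0 T, x t = x 0 + ∫ s in (0 : ℝ)..t, (y s - z s)) :
    ∀ t ∈ Icc 0 T, x t = periodicQueue T (fun r => y r - c r) t := by
  set u : ℝ → ℝ := fun r => y r - c r with hu_def
  have hu : ∀ a b, IntervalIntegrable u volume a b := fun a b => (hy a b).sub (hc a b)
  have hup : Function.Periodic u T := fun r => by simp only [hu_def, hyp r, hcp r]
  have hzi : ∀ a b, a ∈ Icc 0 T → b ∈ Icc 0 T → IntervalIntegrable z volume a b := by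
    intro a b ha hb
    refine hz.mono_set ?_
    rw [uIcc_of_le hT.le]
    exact uIcc_subset_Icc ha hb
  have hg : ∀ a b, a ∈ Icc 0 T → b ∈ Icc 0 T →
      IntervalIntegrable (fun s => y s - z s) volume a b := fun a b ha hb =>
    (hy a b).sub (hzi a b ha hb)
  have h0 : (0 : ℝ) ∈ Icc 0 T := ⟨le_rfl, hT.le⟩
  have hinc : ∀ s t, s ∈ Icc 0 T → t ∈ Icc 0 T → x t = x s + ∫ r in s..t, (y r - z r) := by
    intro s t hs ht
    have h1 := intervalIntegral.integral_add_adjacent_intervals (hg 0 s h0 hs) (hg s t hs ht)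
    rw [hq t ht, hq s hs]
    linarith
  have hxc : ContinuousOn x (Icc 0 T) := by
    have h1 := intervalIntegral.continuousOn_primitive_interval' (hg 0 T h0 ⟨hT.le, le_rfl⟩)
      (by rw [uIcc_of_le hT.le]; exact h0)
    rw [uIcc_of_le hT.le] at h1
    exact (h1.const_add (x 0)).congr fun t ht => hq t ht
  have hQc : ContinuousOn (periodicQueue T u) (Icc 0 T) :=
    (continuous_periodicQueue hT hu hup hneg).continuousOn
  have hQn := periodicQueue_nonneg hT hu
  intro t ht
  have hsub : ∀ s ∈ Icc 0 t, s ∈ Icc 0 T := fun s hs => ⟨hs.1, hs.2.trans ht.2⟩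
  have hsub' : Icc 0 t ⊆ Icc 0 T := fun s hs => hsub s hs
  -- Go back to the last time `s` at which the strict inequality fails. If `x` is below the periodic
  -- queue after `s`, the latter is positive and grows at rate exactly `y - c`, whereas `x` grows at
  -- rate at least `y - c`. If `x` is above, then `x` is positive and grows at rate exactly `y - c`,
  -- whereas the periodic queue grows at least that fast. Either way the gap cannot open.
  rcases lt_trichotomy (x t) (periodicQueue T u t) with h | h | h
  · obtain ⟨s, hs, h1, h2⟩ := exists_last_nonpos ht.1 ((hQc.sub hxc).mono hsub')
      (by simp [hx0]) (by simpa using h)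
    simp only [sub_nonpos, sub_pos, Pi.sub_apply] at h1 h2
    have h3 := periodicQueue_eq_of_pos hT hu hup hneg hs.2.le fun r hr =>
      (hxn r (hsub r ⟨hs.1.trans hr.1.le, hr.2⟩)).trans_lt (h2 r hr)
    have hsT := hsub s ⟨hs.1, hs.2.le⟩
    have h4 := hinc s t hsT ht
    have h5 : ∫ r in s..t, u r ≤ ∫ r in s..t, (y r - z r) :=
      intervalIntegral.integral_mono_on hs.2.le (hu s t) (hg s t hsT ht) fun r hr => by
        have := hzo r (hsub r ⟨hs.1.trans hr.1, hr.2⟩)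
        have h6 : z r ≤ c r := this ▸ linkOutflow_le
        simp only [hu_def]
        linarith
    linarith
  · exact h
  · obtain ⟨s, hs, h1, h2⟩ := exists_last_nonpos ht.1 ((hxc.sub hQc).mono hsub')
      (by simp [hx0]) (by simpa using h)
    simp only [sub_nonpos, sub_pos, Pi.sub_apply] at h1 h2
    have h3 := periodicQueue_add_integral_le hT hu hup hneg hs.2.le
    have hsT := hsub s ⟨hs.1, hs.2.le⟩
    have h4 := hinc s t hsT ht
    have h5 : ∫ r in s..t, u r = ∫ r in s..t, (y r - z r) := by
      refine intervalIntegral.integral_congr_ae (ae_of_all _ fun r hr => ?_)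
      rw [uIoc_of_le hs.2.le] at hr
      have := hzo r (hsub r ⟨hs.1.trans hr.1.le, hr.2⟩)
      rw [linkOutflow_of_pos ((hQn r).trans_lt (h2 r hr))] at this
      simp only [hu_def, this]
    linarith

/-! ## Step functions -/

/-- `f` is locally constant to the right of every point, including the point, and to the left of
every point, excluding the point. -/
def IsStep (f : ℝ → ℝ) : Prop :=
  ∀ t, (∀ᶠ s in 𝓝[>] t, f s = f t) ∧ ∃ v, ∀ᶠ s in 𝓝[<] t, f s = v

theorem tendsto_sub_nhdsGT (d t : ℝ) : Tendsto (fun s => s - d) (𝓝[>] t) (𝓝[>] (t - d)) :=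
  (continuous_sub_right d).continuousWithinAt.tendsto_nhdsWithin
    fun _ hs => sub_lt_sub_right hs d

theorem tendsto_sub_nhdsLT (d t : ℝ) : Tendsto (fun s => s - d) (𝓝[<] t) (𝓝[<] (t - d)) :=
  (continuous_sub_right d).continuousWithinAt.tendsto_nhdsWithin
    fun _ hs => sub_lt_sub_right hs d

namespace IsStep

variable {f g : ℝ → ℝ}

theorem const (a : ℝ) : IsStep fun _ => a :=
  fun _ => ⟨Eventually.of_forall fun _ => rfl, a, Eventually.of_forall fun _ => rfl⟩

theorem comp₂ (F : ℝ → ℝ → ℝ) (hf : IsStep f) (hg : IsStep g) :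
    IsStep fun t => F (f t) (g t) := by
  intro t
  obtain ⟨v, hv⟩ := (hf t).2
  obtain ⟨w, hw⟩ := (hg t).2
  refine ⟨?_, F v w, ?_⟩
  · filter_upwards [(hf t).1, (hg t).1] with s h1 h2
    rw [h1, h2]
  · filter_upwards [hv, hw] with s h1 h2
    rw [h1, h2]

theorem shift (hf : IsStep f) (d : ℝ) : IsStep fun t => f (t - d) := by
  intro t
  obtain ⟨v, hv⟩ := (hf (t - d)).2
  exact ⟨(tendsto_sub_nhdsGT d t).eventually (hf (t - d)).1, v,
    (tendsto_sub_nhdsLT d t).eventually hv⟩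

theorem sum {ι : Type*} (s : Finset ι) {f : ι → ℝ → ℝ} (hf : ∀ i ∈ s, IsStep (f i)) :
    IsStep fun t => ∑ i ∈ s, f i t := by
  classical
  induction s using Finset.induction_on with
  | empty => simpa using const 0
  | insert a s ha ih =>
    simp only [Finset.sum_insert ha]
    exact comp₂ (· + ·) (hf a (Finset.mem_insert_self a s))
      (ih fun i hi => hf i (Finset.mem_insert_of_mem hi))

theorem locallyIntegrable (hf : IsStep f) : LocallyIntegrable f volume := by
  intro t
  rw [← nhdsLT_sup_nhdsGE, IntegrableAtFilter.sup_iff]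
  have hfin : ∀ s : Set ℝ, s ⊆ Icc (t - 1) (t + 1) → volume s < ⊤ := fun s hs =>
    (measure_mono hs).trans_lt (by simp)
  constructor
  · obtain ⟨v, hv⟩ := (hf t).2
    obtain ⟨a, ha, h⟩ := mem_nhdsLT_iff_exists_Ioo_subset.1 hv
    refine ⟨Ioo (max a (t - 1)) t, Ioo_mem_nhdsLT (max_lt ha (by linarith)), ?_⟩
    refine (integrableOn_const (C := v) (hfin _ fun s hs => ?_).ne).congr_fun
      (fun s hs => (h ⟨(le_max_left _ _).trans_lt hs.1, hs.2⟩).symm) measurableSet_Ioo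
    exact ⟨(le_max_right _ _).trans hs.1.le, by linarith [hs.2]⟩
  · obtain ⟨b, hb, h⟩ := mem_nhdsGT_iff_exists_Ioo_subset.1 (hf t).1
    refine ⟨Ico t (min b (t + 1)), Ico_mem_nhdsGE (lt_min hb (by linarith)), ?_⟩
    refine (integrableOn_const (C := f t) (hfin _ fun s hs => ?_).ne).congr_fun
      (fun s hs => ?_) measurableSet_Ico
    · exact ⟨by linarith [hs.1], hs.2.le.trans (min_le_right _ _)⟩
    · rcases hs.1.eq_or_lt with h' | h'
      · rw [h']
      · exact (h ⟨h', hs.2.trans_le (min_le_left _ _)⟩).symm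

theorem intervalIntegrable (hf : IsStep f) (a b : ℝ) : IntervalIntegrable f volume a b :=
  (hf.locallyIntegrable.integrableOn_isCompact isCompact_uIcc).intervalIntegrable

end IsStep

theorem exists_mem_Ico_of_partition {n : ℕ} {t : Fin (n + 1) → ℝ} {s : ℝ} (h0 : t 0 ≤ s)
    (hs : s < t (Fin.last n)) : ∃ k : Fin n, s ∈ Ico (t k.castSucc) (t k.succ) := by
  induction n with
  | zero => exact absurd (h0.trans_lt hs) (lt_irrefl _)
  | succ n ih =>
    rcases lt_or_ge s (t (Fin.last n).castSucc) with h | h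
    · obtain ⟨k, hk⟩ := ih (t := fun i => t i.castSucc) h0 h
      exact ⟨k.castSucc, hk⟩
    · exact ⟨Fin.last n, h, by simpa using hs⟩

theorem exists_mem_Ioc_of_partition {n : ℕ} {t : Fin (n + 1) → ℝ} {s : ℝ} (h0 : t 0 < s)
    (hs : s ≤ t (Fin.last n)) : ∃ k : Fin n, s ∈ Ioc (t k.castSucc) (t k.succ) := by
  induction n with
  | zero => exact absurd (h0.trans_le hs) (lt_irrefl _)
  | succ n ih =>
    rcases le_or_gt s (t (Fin.last n).castSucc) with h | h
    · obtain ⟨k, hk⟩ := ih (t := fun i => t i.castSucc) h0 h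
      exact ⟨k.castSucc, hk⟩
    · exact ⟨Fin.last n, h, by simpa using hs⟩

theorem PiecewiseConstantOn.isStep {T : ℝ} (hT : 0 < T) {f : ℝ → ℝ}
    (hf : PiecewiseConstantOn T f) (hp : Function.Periodic f T) : IsStep f := by
  obtain ⟨n, t, -, h0, hl, hc⟩ := hf
  intro s
  constructor
  -- To the right of `s`, reduce modulo `T` into `[0, T)`, so that the reduced point has room on its
  -- right inside a piece.
  · have hm := toIcoMod_mem_Ico hT 0 s
    rw [toIcoMod] at hm
    set d := toIcoDiv hT 0 s • T
    have hfd : ∀ r, f (r - d) = f r := fun r => hp.sub_zsmul_eq _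
    obtain ⟨k, hk⟩ := exists_mem_Ico_of_partition (t := t) (s := s - d) (by rw [h0]; exact hm.1)
      (by rw [hl]; simpa using hm.2)
    filter_upwards [(tendsto_sub_nhdsGT d s).eventually (Ioo_mem_nhdsGT hk.2)] with r hr
    rw [← hfd r, ← hfd s, hc k _ hk, hc k _ ⟨hk.1.trans hr.1.le, hr.2⟩]
  -- To the left of `s`, reduce into `(0, T]` instead, so that a multiple of `T` is approached
  -- through the last piece.
  · have hm := toIocMod_mem_Ioc hT 0 s
    rw [toIocMod] at hm
    set d := toIocDiv hT 0 s • T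
    have hfd : ∀ r, f (r - d) = f r := fun r => hp.sub_zsmul_eq _
    obtain ⟨k, hk⟩ := exists_mem_Ioc_of_partition (t := t) (s := s - d) (by rw [h0]; exact hm.1)
      (by rw [hl]; simpa using hm.2)
    refine ⟨f (t k.castSucc), ?_⟩
    filter_upwards [(tendsto_sub_nhdsLT d s).eventually (Ioo_mem_nhdsLT hk.1)] with r hr
    rw [← hfd r, hc k _ ⟨hr.1.le, hr.2.trans_le hk.2⟩]

/-! ## The periodic queue for step functions -/

section StepQueue

variable {T : ℝ} {u : ℝ → ℝ}

theorem integral_eq_mul_of_forall_Ioo {u : ℝ → ℝ} {a b v : ℝ} (hab : a ≤ b)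
    (h : ∀ r ∈ Ioo a b, u r = v) : ∫ r in a..b, u r = v * (b - a) := by
  rw [intervalIntegral.integral_of_le hab, integral_Ioc_eq_integral_Ioo,
    setIntegral_congr_fun measurableSet_Ioo h, ← integral_Ioc_eq_integral_Ioo,
    ← intervalIntegral.integral_of_le hab, intervalIntegral.integral_const, smul_eq_mul, mul_comm]

/-- If the queue were positive at `t`, then after its last zero it would have grown by the integral
of a nonpositive rate. -/
theorem periodicQueue_eq_zero_of_nonpos (hT : 0 < T) (hi : ∀ a b, IntervalIntegrable u volume a b)
    (hp : Function.Periodic u T) (hneg : ∫ r in (0 : ℝ)..T, u r ≤ 0) {s t : ℝ} (hst : s ≤ t)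
    (hs : periodicQueue T u s = 0) (hu : ∀ r ∈ Ioo s t, u r ≤ 0) : periodicQueue T u t = 0 := by
  by_contra hne
  have hpos := lt_of_le_of_ne (periodicQueue_nonneg hT hi t) (Ne.symm hne)
  obtain ⟨r, hr, h1, h2⟩ := exists_last_nonpos hst
    (continuous_periodicQueue hT hi hp hneg).continuousOn hs.le hpos
  have h3 := periodicQueue_eq_of_pos hT hi hp hneg hr.2.le h2
  have h4 : ∫ q in r..t, u q ≤ ∫ q in r..t, (0 : ℝ) :=
    intervalIntegral.integral_mono_on_of_le_Ioo hr.2.le (hi r t) (by simp)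
      fun q hq => hu q ⟨hr.1.trans_lt hq.1, hq.2⟩
  simp at h4
  linarith

variable {y c : ℝ → ℝ}

/-- Just after `t` both rates are constant. An empty queue with `y ≤ c` stays empty and passes on
`y`; an empty queue with `y > c` becomes positive at once, but `min c y = c` already, so the outflow
does not jump; a positive queue stays positive by continuity. This yields both the right derivative
of the queue and the right constancy of the outflow. -/
theorem eventually_right_periodicQueue (hT : 0 < T) (hy : IsStep y) (hc : IsStep c)
    (hyp : Function.Periodic y T) (hcp : Function.Periodic c T)
    (hneg : ∫ r in (0 : ℝ)..T, (y r - c r) ≤ 0) (t : ℝ) :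
    ∀ᶠ s in 𝓝[>] t,
      periodicQueue T (fun r => y r - c r) s = periodicQueue T (fun r => y r - c r) t +
        (y t - linkOutflow (periodicQueue T (fun r => y r - c r) t) (y t) (c t)) * (s - t) ∧
      linkOutflow (periodicQueue T (fun r => y r - c r) s) (y s) (c s) =
        linkOutflow (periodicQueue T (fun r => y r - c r) t) (y t) (c t) := by
  set u : ℝ → ℝ := fun r => y r - c r with hu_def
  have hu : IsStep u := IsStep.comp₂ (· - ·) hy hc
  have hi := hu.intervalIntegrable
  have hup : Function.Periodic u T := fun r => by simp only [hu_def, hyp r, hcp r]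
  have hQc := continuous_periodicQueue hT hi hup hneg
  have hQn := periodicQueue_nonneg hT hi
  obtain ⟨b, hb, hbu⟩ := mem_nhdsGT_iff_exists_Ioo_subset.1 (hu t).1
  have hint : ∀ s ∈ Ioo t b, ∫ r in t..s, u r = u t * (s - t) := fun s hs =>
    integral_eq_mul_of_forall_Ioo hs.1.le fun r hr => hbu ⟨hr.1, hr.2.trans hs.2⟩
  rcases (hQn t).eq_or_lt with h0 | hpos
  · rw [← h0, linkOutflow_of_nonpos le_rfl]
    rcases le_or_gt (u t) 0 with hut | hut
    · have hle : y t ≤ c t := by simpa [hu_def] using hut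
      filter_upwards [(hy t).1, (hc t).1, Ioo_mem_nhdsGT hb] with s h1 h2 hs
      have hQs : periodicQueue T u s = 0 :=
        periodicQueue_eq_zero_of_nonpos hT hi hup hneg hs.1.le h0.symm fun r hr =>
          (hbu (show r ∈ Ioo t b from ⟨hr.1, hr.2.trans hs.2⟩)).trans_le hut
      rw [hQs, h1, h2, linkOutflow_of_nonpos le_rfl, min_eq_right hle]
      simp
    · have hle : c t ≤ y t := by
        simp only [hu_def] at hut
        linarith
      have hposr : ∀ s ∈ Ioo t b, 0 < periodicQueue T u s := fun s hs => by
        have h1 := periodicQueue_add_integral_le hT hi hup hneg hs.1.le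
        rw [hint s hs, ← h0] at h1
        have : 0 < u t * (s - t) := mul_pos hut (sub_pos.2 hs.1)
        linarith
      filter_upwards [(hy t).1, (hc t).1, Ioo_mem_nhdsGT hb] with s h1 h2 hs
      rw [linkOutflow_of_pos (hposr s hs), h2, min_eq_left hle]
      refine ⟨?_, rfl⟩
      rw [periodicQueue_eq_of_pos hT hi hup hneg hs.1.le
        fun r hr => hposr r ⟨hr.1, hr.2.trans_lt hs.2⟩, hint s hs, ← h0]
  · rw [linkOutflow_of_pos hpos]
    have hev : ∀ᶠ s in 𝓝[>] t, 0 < periodicQueue T u s :=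
      (hQc.continuousWithinAt.eventually (lt_mem_nhds hpos))
    obtain ⟨b', hb', hbQ⟩ := mem_nhdsGT_iff_exists_Ioo_subset.1 hev
    filter_upwards [(hc t).1, Ioo_mem_nhdsGT hb, Ioo_mem_nhdsGT hb'] with s h2 hs hs'
    rw [linkOutflow_of_pos (hbQ hs'), h2]
    refine ⟨?_, rfl⟩
    rw [periodicQueue_eq_of_pos hT hi hup hneg hs.1.le
        fun r hr => hbQ ⟨hr.1, hr.2.trans_lt hs'.2⟩, hint s hs]

/-- Just before `t` the net inflow rate is constant. If the queue vanishes somewhere in that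
interval, it stays zero from there on or is positive from there on, according to the sign of the
rate; otherwise it is positive throughout. -/
theorem exists_eventually_left_outflow (hT : 0 < T) (hy : IsStep y) (hc : IsStep c)
    (hyp : Function.Periodic y T) (hcp : Function.Periodic c T)
    (hneg : ∫ r in (0 : ℝ)..T, (y r - c r) ≤ 0) (t : ℝ) :
    ∃ v, ∀ᶠ s in 𝓝[<] t,
      linkOutflow (periodicQueue T (fun r => y r - c r) s) (y s) (c s) = v := by
  set u : ℝ → ℝ := fun r => y r - c r with hu_def
  have hu : IsStep u := IsStep.comp₂ (· - ·) hy hc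
  have hi := hu.intervalIntegrable
  have hup : Function.Periodic u T := fun r => by simp only [hu_def, hyp r, hcp r]
  have hQc := continuous_periodicQueue hT hi hup hneg
  have hQn := periodicQueue_nonneg hT hi
  obtain ⟨yv, hyv⟩ := (hy t).2
  obtain ⟨cv, hcv⟩ := (hc t).2
  have huv : ∀ᶠ s in 𝓝[<] t, u s = yv - cv := by
    filter_upwards [hyv, hcv] with s h1 h2
    simp only [hu_def, h1, h2]
  obtain ⟨a, ha, hau⟩ := mem_nhdsLT_iff_exists_Ioo_subset.1 huv
  by_cases hex : ∃ s ∈ Ioo a t, periodicQueue T u s = 0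
  · obtain ⟨s, hs, h0⟩ := hex
    rcases le_or_gt (yv - cv) 0 with hle | hgt
    · refine ⟨min cv yv, ?_⟩
      filter_upwards [hyv, hcv, Ioo_mem_nhdsLT hs.2] with r h1 h2 hr
      have hr0 : periodicQueue T u r = 0 :=
        periodicQueue_eq_zero_of_nonpos hT hi hup hneg hr.1.le h0 fun q hq =>
          (hau (show q ∈ Ioo a t from ⟨hs.1.trans hq.1, hq.2.trans hr.2⟩)).trans_le hle
      rw [hr0, linkOutflow_of_nonpos le_rfl, h1, h2]
    · refine ⟨cv, ?_⟩
      filter_upwards [hcv, Ioo_mem_nhdsLT hs.2] with r h2 hr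
      have h3 := periodicQueue_add_integral_le hT hi hup hneg hr.1.le
      rw [h0, integral_eq_mul_of_forall_Ioo hr.1.le fun q hq =>
        hau (show q ∈ Ioo a t from ⟨hs.1.trans hq.1, hq.2.trans hr.2⟩)] at h3
      have : 0 < (yv - cv) * (r - s) := mul_pos hgt (sub_pos.2 hr.1)
      rw [linkOutflow_of_pos (by linarith), h2]
  · push Not at hex
    refine ⟨cv, ?_⟩
    filter_upwards [hcv, Ioo_mem_nhdsLT ha] with r h2 hr
    rw [linkOutflow_of_pos (lt_of_le_of_ne (hQn r) (hex r hr).symm), h2]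

theorem IsStep.outflow (hT : 0 < T) (hy : IsStep y) (hc : IsStep c)
    (hyp : Function.Periodic y T) (hcp : Function.Periodic c T)
    (hneg : ∫ r in (0 : ℝ)..T, (y r - c r) ≤ 0) :
    IsStep fun t => linkOutflow (periodicQueue T (fun r => y r - c r) t) (y t) (c t) := fun t =>
  ⟨(eventually_right_periodicQueue hT hy hc hyp hcp hneg t).mono fun _ h => h.2,
    exists_eventually_left_outflow hT hy hc hyp hcp hneg t⟩

theorem periodicQueue_eq_add_integral (hT : 0 < T) (hy : IsStep y) (hc : IsStep c)
    (hyp : Function.Periodic y T) (hcp : Function.Periodic c T)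
    (hneg : ∫ r in (0 : ℝ)..T, (y r - c r) ≤ 0) {a b : ℝ} (hab : a ≤ b) :
    periodicQueue T (fun r => y r - c r) b = periodicQueue T (fun r => y r - c r) a +
      ∫ s in a..b, (y s - linkOutflow (periodicQueue T (fun r => y r - c r) s) (y s) (c s)) := by
  have hu : IsStep fun r => y r - c r := IsStep.comp₂ (· - ·) hy hc
  have hup : Function.Periodic (fun r => y r - c r) T := fun r => by simp only [hyp r, hcp r]
  have hz := IsStep.outflow hT hy hc hyp hcp hneg
  -- A continuous function with a right derivative everywhere suffices for the fundamental theorem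
  -- of calculus, so no exceptional set of jump times has to be removed.
  have h := intervalIntegral.integral_eq_sub_of_hasDeriv_right_of_le hab
    (f := periodicQueue T (fun r => y r - c r))
    (f' := fun s => y s - linkOutflow (periodicQueue T (fun r => y r - c r) s) (y s) (c s))
    (continuous_periodicQueue hT hu.intervalIntegrable hup hneg).continuousOn
    (fun t _ => ?_) ((hy.intervalIntegrable a b).sub (hz.intervalIntegrable a b))
  · rw [h]
    ring
  · set w := linkOutflow (periodicQueue T (fun r => y r - c r) t) (y t) (c t)
    have hd : HasDerivAt (fun s => periodicQueue T (fun r => y r - c r) t + (y t - w) * (s - t))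
        (y t - w) t := by
      simpa using (((hasDerivAt_id t).sub_const t).const_mul (y t - w)).const_add
        (periodicQueue T (fun r => y r - c r) t)
    refine hd.hasDerivWithinAt.congr_of_eventuallyEq ?_ (by simp)
    exact (eventually_right_periodicQueue hT hy hc hyp hcp hneg t).mono fun _ h => h.1

end StepQueue

/-! ## Positive and negative sets -/

section Intervals

variable {T : ℝ} {f g y c : ℝ → ℝ}

theorem IsMaximalInterval.eq_component {S : Set ℝ} (hS : IsMaximalInterval T f g S) {s : ℝ}
    (hs : s ∈ S) : S = ordConnectedComponent {t | t ∈ Ico 0 T ∧ f t < g t} s := by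
  have hoc := hS.1.prop.1
  have h1 : S ⊆ ordConnectedComponent {t | t ∈ Ico 0 T ∧ f t < g t} s :=
    subset_ordConnectedComponent hs hS.1.prop.2
  exact h1.antisymm (hS.1.2 ⟨inferInstance, ordConnectedComponent_subset⟩ h1)

theorem IsMaximalInterval.mem_of_uIcc {S : Set ℝ} (hS : IsMaximalInterval T f g S) {s t : ℝ}
    (hs : s ∈ S) (h : ∀ r ∈ uIcc s t, r ∈ Ico 0 T ∧ f r < g r) : t ∈ S := by
  rw [hS.eq_component hs]
  exact mem_ordConnectedComponent.2 h

theorem eventually_lt_right (hf : IsStep f) (hg : IsStep g) {t : ℝ} (h : f t < g t) :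
    ∀ᶠ s in 𝓝[>] t, f s < g s := by
  filter_upwards [(hf t).1, (hg t).1] with s h1 h2
  rwa [h1, h2]

theorem isMaximalInterval_component (hf : IsStep f) (hg : IsStep g) {t : ℝ} (ht : t ∈ Ico 0 T)
    (h : f t < g t) :
    IsMaximalInterval T f g (ordConnectedComponent {t | t ∈ Ico 0 T ∧ f t < g t} t) := by
  have htP : t ∈ {t | t ∈ Ico 0 T ∧ f t < g t} := ⟨ht, h⟩
  refine ⟨⟨⟨inferInstance, ordConnectedComponent_subset⟩, fun A hA hsub => ?_⟩, ?_⟩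
  · have := hA.1
    exact subset_ordConnectedComponent (hsub (self_mem_ordConnectedComponent.2 htP)) hA.2
  · obtain ⟨b, hb, hbs⟩ := mem_nhdsGT_iff_exists_Ioo_subset.1
      ((eventually_lt_right hf hg h).and (Ioo_mem_nhdsGT ht.2))
    have hb' : t < b := hb
    refine ⟨t, self_mem_ordConnectedComponent.2 htP, (t + b) / 2,
      mem_ordConnectedComponent.2 fun r hr => ?_, by linarith⟩
    rw [uIcc_of_le (by linarith)] at hr
    rcases hr.1.eq_or_lt with h' | h'
    · exact h' ▸ htP
    · have h2 := hbs (show r ∈ Ioo t b from ⟨h', by linarith [hr.2]⟩)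
      exact ⟨⟨ht.1.trans h'.le, h2.2.2⟩, h2.1⟩

theorem IsMaximalInterval.bddBelow {S : Set ℝ} (hS : IsMaximalInterval T f g S) : BddBelow S :=
  ⟨0, fun _ hs => (hS.1.prop.2 hs).1.1⟩

theorem IsMaximalInterval.bddAbove {S : Set ℝ} (hS : IsMaximalInterval T f g S) : BddAbove S :=
  ⟨T, fun _ hs => (hS.1.prop.2 hs).1.2.le⟩

theorem IsMaximalInterval.mem_of_sInf_lt {S : Set ℝ} (hS : IsMaximalInterval T f g S) {s t : ℝ}
    (ht : t ∈ S) (h : sInf S < s) (hst : s ≤ t) : s ∈ S := by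
  obtain ⟨q, hq, hqs⟩ := exists_lt_of_csInf_lt ⟨t, ht⟩ h
  exact hS.1.prop.1.out hq ht ⟨hqs.le, hst⟩

theorem IsMaximalInterval.mem_of_lt_sSup {S : Set ℝ} (hS : IsMaximalInterval T f g S) {s t : ℝ}
    (ht : t ∈ S) (h : s < sSup S) (hst : t ≤ s) : s ∈ S := by
  obtain ⟨q, hq, hqs⟩ := exists_lt_of_lt_csSup ⟨t, ht⟩ h
  exact hS.1.prop.1.out ht hq ⟨hst, hqs.le⟩

theorem exists_mem_positiveLeft (hy : IsStep y) (hc : IsStep c) {t : ℝ} (ht : t ∈ Ico 0 T)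
    (h : c t < y t) : ∃ w ∈ positiveLeft T y c, w ≤ t ∧ ∀ s ∈ Ioc w t, c s < y s := by
  have hS := isMaximalInterval_component hc hy ht h
  have htS := self_mem_ordConnectedComponent.2 (show t ∈ {t | t ∈ Ico 0 T ∧ c t < y t} from ⟨ht, h⟩)
  exact ⟨_, ⟨_, hS, rfl⟩, csInf_le hS.bddBelow htS,
    fun s hs => (hS.1.prop.2 (hS.mem_of_sInf_lt htS hs.1 hs.2)).2⟩

theorem exists_mem_negativeRight (hy : IsStep y) (hc : IsStep c) {t : ℝ} (ht : t ∈ Ico 0 T)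
    (h : y t < c t) :
    ∃ b ∈ negativeRight T y c, t < b ∧ b ≤ T ∧ ∀ s ∈ Ico t b, y s < c s := by
  have hS := isMaximalInterval_component hy hc ht h
  have htS := self_mem_ordConnectedComponent.2 (show t ∈ {t | t ∈ Ico 0 T ∧ y t < c t} from ⟨ht, h⟩)
  refine ⟨_, ⟨_, hS, rfl⟩, ?_, csSup_le ⟨t, htS⟩ fun s hs => (hS.1.prop.2 hs).1.2.le,
    fun s hs => (hS.1.prop.2 (hS.mem_of_lt_sSup htS hs.2 hs.1)).2⟩
  obtain ⟨b, hb, hbs⟩ := mem_nhdsGT_iff_exists_Ioo_subset.1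
    ((eventually_lt_right hy hc h).and (Ioo_mem_nhdsGT ht.2))
  have hb' : t < b := hb
  have hm : (t + b) / 2 ∈ ordConnectedComponent {t | t ∈ Ico 0 T ∧ y t < c t} t := by
    refine hS.mem_of_uIcc htS fun r hr => ?_
    rw [uIcc_of_le (by linarith)] at hr
    rcases hr.1.eq_or_lt with h' | h'
    · exact h' ▸ ⟨ht, h⟩
    · have h2 := hbs (show r ∈ Ioo t b from ⟨h', by linarith [hr.2]⟩)
      exact ⟨⟨ht.1.trans h'.le, h2.2.2⟩, h2.1⟩
  have := le_csSup hS.bddAbove hm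
  linarith

theorem mem_Ico_of_mem_positiveLeft {w : ℝ} (hw : w ∈ positiveLeft T y c) : w ∈ Ico 0 T := by
  obtain ⟨S, hS, rfl⟩ := hw
  obtain ⟨a, ha⟩ := hS.2.nonempty
  exact ⟨le_csInf ⟨a, ha⟩ fun s hs => (hS.1.prop.2 hs).1.1,
    (csInf_le hS.bddBelow ha).trans_lt (hS.1.prop.2 ha).1.2⟩

/-- Points of the positive set lie arbitrarily close to the right of its infimum, and the values at
the infimum agree with the values there. -/
theorem lt_of_mem_positiveLeft (hy : IsStep y) (hc : IsStep c) {w : ℝ}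
    (hw : w ∈ positiveLeft T y c) : c w < y w := by
  obtain ⟨S, hS, rfl⟩ := hw
  obtain ⟨a, ha, b, hb, hab⟩ := hS.2.exists_lt
  have hlt : sInf S < b := (csInf_le hS.bddBelow ha).trans_lt hab
  obtain ⟨s, ⟨h1, h2⟩, hs⟩ := (((hy (sInf S)).1.and (hc (sInf S)).1).and (Ioo_mem_nhdsGT hlt)).exists
  rw [← h1, ← h2]
  exact (hS.1.prop.2 (hS.mem_of_sInf_lt hb hs.1 hs.2.le)).2

/-- Every point has a neighbourhood in which it is the only possible jump; compactness does the
rest. -/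
theorem IsStep.finite_jumps (hf : IsStep f) (a b : ℝ) :
    {t ∈ Icc a b | ¬ ∀ᶠ s in 𝓝 t, f s = f t}.Finite := by
  have hloc : ∀ t ∈ Icc a b, ∃ U ∈ 𝓝 t, ({t | ¬ ∀ᶠ s in 𝓝 t, f s = f t} ∩ U).Finite := by
    intro t _
    obtain ⟨v, hv⟩ := (hf t).2
    obtain ⟨p, hp, hpv⟩ := mem_nhdsLT_iff_exists_Ioo_subset.1 hv
    obtain ⟨q, hq, hqv⟩ := mem_nhdsGT_iff_exists_Ioo_subset.1 (hf t).1
    refine ⟨Ioo p q, Ioo_mem_nhds hp hq, (finite_singleton t).subset ?_⟩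
    rintro s ⟨hs, hsI⟩
    by_contra hne
    apply hs
    rcases lt_or_gt_of_ne hne with h | h
    · filter_upwards [Ioo_mem_nhds hsI.1 h] with r hr
      rw [show f r = v from hpv hr, show f s = v from hpv ⟨hsI.1, h⟩]
    · filter_upwards [Ioo_mem_nhds h hsI.2] with r hr
      rw [show f r = f t from hqv hr, show f s = f t from hqv ⟨h, hsI.2⟩]
  have := isCompact_Icc.induction_on
    (p := fun A => ({t | ¬ ∀ᶠ s in 𝓝 t, f s = f t} ∩ A).Finite) (s := Icc a b) (by simp)
    (fun A B hAB hB => hB.subset (inter_subset_inter_right _ hAB))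
    (fun A B hA hB => by
      rw [inter_union_distrib_left]
      exact hA.union hB)
    (fun t ht => by
      obtain ⟨U, hU, h⟩ := hloc t ht
      exact ⟨U, mem_nhdsWithin_of_mem_nhds hU, h⟩)
  exact this.subset fun t ht => ⟨ht.2, ht.1⟩

/-- A left endpoint other than `0` must be a jump of `y - c`; otherwise the positive set could be
enlarged to the left, against maximality. -/
theorem finite_positiveLeft (hy : IsStep y) (hc : IsStep c) : (positiveLeft T y c).Finite := by
  have hu : IsStep fun t => y t - c t := IsStep.comp₂ (· - ·) hy hc
  refine ((hu.finite_jumps 0 T).union (finite_singleton 0)).subset fun w hw => ?_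
  by_contra hcon
  simp only [mem_union, mem_ofPred_eq, mem_singleton_iff, not_or, not_and, not_not] at hcon
  have hwT := mem_Ico_of_mem_positiveLeft hw
  have hpos := lt_of_mem_positiveLeft hy hc hw
  have hw0 : 0 < w := lt_of_le_of_ne hwT.1 (Ne.symm hcon.2)
  obtain ⟨a, ha, has⟩ := mem_nhdsLE_iff_exists_Ioc_subset.1
    (nhdsWithin_le_nhds ((hcon.1 ⟨hwT.1, hwT.2.le⟩).and (lt_mem_nhds hw0)))
  have ha' : a < w := ha
  obtain ⟨S, hS, rfl⟩ := hw
  obtain ⟨s, hs⟩ := hS.2.nonempty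
  have hsP := hS.1.prop.2 hs
  have hle := csInf_le hS.bddBelow hs
  have hmem : (a + sInf S) / 2 ∈ S := by
    refine hS.mem_of_uIcc hs fun r hr => ?_
    rw [uIcc_of_ge (by linarith)] at hr
    rcases le_or_gt r (sInf S) with h | h
    · have h2 := has (show r ∈ Ioc a (sInf S) from ⟨by linarith [hr.1], h⟩)
      exact ⟨⟨h2.2.le, h.trans_lt hwT.2⟩, by linarith [h2.1]⟩
    · exact hS.1.prop.2 (hS.mem_of_sInf_lt hs h hr.2)
  have := csInf_le hS.bddBelow hmem
  linarith

/-- As for left endpoints, but the exceptional point is `T`, and an endpoint where `y - c` does not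
jump allows an enlargement to the right. -/
theorem finite_negativeRight (hy : IsStep y) (hc : IsStep c) : (negativeRight T y c).Finite := by
  have hu : IsStep fun t => y t - c t := IsStep.comp₂ (· - ·) hy hc
  refine ((hu.finite_jumps 0 T).union (finite_singleton T)).subset fun b hb => ?_
  by_contra hcon
  simp only [mem_union, mem_ofPred_eq, mem_singleton_iff, not_or, not_and, not_not] at hcon
  obtain ⟨S, hS, rfl⟩ := hb
  obtain ⟨p, hp, q, hq, hpq⟩ := hS.2.exists_lt
  have hpP := hS.1.prop.2 hp
  have hlt : p < sSup S := hpq.trans_le (le_csSup hS.bddAbove hq)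
  have hbT : sSup S < T :=
    lt_of_le_of_ne (csSup_le ⟨p, hp⟩ fun s hs => (hS.1.prop.2 hs).1.2.le) hcon.2
  have hev := (hcon.1 ⟨hpP.1.1.trans hlt.le, hbT.le⟩)
  have hneg : y (sSup S) < c (sSup S) := by
    obtain ⟨s, h1, hs⟩ := ((hev.filter_mono nhdsWithin_le_nhds).and (Ioo_mem_nhdsLT hlt)).exists
    have := (hS.1.prop.2 (hS.mem_of_lt_sSup hp hs.2 hs.1.le)).2
    linarith
  obtain ⟨e, he, hes⟩ := mem_nhdsGE_iff_exists_Ico_subset.1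
    (nhdsWithin_le_nhds (hev.and (gt_mem_nhds hbT)))
  have he' : sSup S < e := he
  have hmem : (sSup S + e) / 2 ∈ S := by
    refine hS.mem_of_uIcc hp fun r hr => ?_
    rw [uIcc_of_le (by linarith)] at hr
    rcases lt_or_ge r (sSup S) with h | h
    · exact hS.1.prop.2 (hS.mem_of_lt_sSup hp h hr.1)
    · have h2 := hes (show r ∈ Ico (sSup S) e from ⟨h, by linarith [hr.2]⟩)
      exact ⟨⟨hpP.1.1.trans hr.1, h2.2⟩, by linarith [h2.1]⟩
  have := le_csSup hS.bddAbove hmem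
  linarith

end Intervals

/-! ## Correctness of the initial queue length -/

section InitialQueue

variable {T : ℝ} {y c : ℝ → ℝ}

theorem integral_nonpos_of_forall_Ioo {u : ℝ → ℝ} (hi : ∀ a b, IntervalIntegrable u volume a b)
    {a b : ℝ} (hab : a ≤ b) (h : ∀ r ∈ Ioo a b, u r ≤ 0) : ∫ r in a..b, u r ≤ 0 := by
  have := intervalIntegral.integral_mono_on_of_le_Ioo hab (hi a b) (by simp) h
    (g := fun _ => (0 : ℝ))
  simpa using this

theorem integral_nonneg_of_forall_Ioo {u : ℝ → ℝ} (hi : ∀ a b, IntervalIntegrable u volume a b)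
    {a b : ℝ} (hab : a ≤ b) (h : ∀ r ∈ Ioo a b, 0 ≤ u r) : 0 ≤ ∫ r in a..b, u r := by
  have := intervalIntegral.integral_mono_on_of_le_Ioo hab (by simp) (hi a b) h
    (f := fun _ => (0 : ℝ))
  simpa using this

/-- Between two consecutive left endpoints of positive sets, the net inflow is first positive and
then nonpositive. -/
theorem forall_lt_or_integral_nonpos (hy : IsStep y) (hc : IsStep c) {a s b : ℝ} (ha : 0 ≤ a)
    (has : a < s) (hsb : s ≤ b) (hb : b ≤ T) (hno : ∀ w ∈ positiveLeft T y c, w ∉ Ioo a b) :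
    (∀ r ∈ Ioo a s, c r < y r) ∨ ∫ r in s..b, (y r - c r) ≤ 0 := by
  have hi := (IsStep.comp₂ (· - ·) hy hc).intervalIntegrable
  by_cases hex : ∃ t ∈ Ioo s b, c t < y t
  · left
    obtain ⟨t, ht, hct⟩ := hex
    obtain ⟨w, hw, hwt, h⟩ := exists_mem_positiveLeft (T := T) hy hc
      ⟨ha.trans (has.le.trans ht.1.le), ht.2.trans_le hb⟩ hct
    have hwa : w ≤ a := by
      by_contra! hlt
      exact hno w hw ⟨hlt, hwt.trans_lt ht.2⟩
    exact fun r hr => h r ⟨hwa.trans_lt hr.1, hr.2.le.trans ht.1.le⟩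
  · right
    push Not at hex
    exact integral_nonpos_of_forall_Ioo hi hsb fun r hr => sub_nonpos.2 (hex r hr)

/-- If no negative set that ends in `(a, e]` witnesses that the queue has been emptied, then the
queue is nonnegative at `e`. -/
theorem integral_nonneg_of_forall_negativeRight (hy : IsStep y) (hc : IsStep c) {q a e : ℝ}
    (ha : 0 ≤ a) (hae : a < e) (heT : e < T) (hpos : c e < y e)
    (hqa : 0 ≤ ∫ r in q..a, (y r - c r))
    (hno : ∀ b ∈ negativeRight T y c, b ∈ Ioc a e → 0 ≤ ∫ r in q..b, (y r - c r)) :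
    0 ≤ ∫ r in q..e, (y r - c r) := by
  have hi := (IsStep.comp₂ (· - ·) hy hc).intervalIntegrable
  have hfin : (negativeRight T y c ∩ Ioc a e).Finite := (finite_negativeRight hy hc).inter_of_left _
  have key : ∀ p, a ≤ p → p ≤ e → (∀ b ∈ negativeRight T y c ∩ Ioc a e, b ≤ p) →
      0 ≤ ∫ r in q..p, (y r - c r) → 0 ≤ ∫ r in q..e, (y r - c r) := by
    intro p hap hpe hmax hqp
    rw [← intervalIntegral.integral_add_adjacent_intervals (hi q p) (hi p e)]
    refine add_nonneg hqp (integral_nonneg_of_forall_Ioo hi hpe fun r hr => ?_)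
    by_contra! hneg
    obtain ⟨b, hb, hrb, -, hlt⟩ := exists_mem_negativeRight (T := T) hy hc
      (t := r) ⟨ha.trans (hap.trans hr.1.le), hr.2.trans heT⟩ (sub_neg.1 hneg)
    have hbe : b ≤ e := by
      by_contra! h
      exact absurd (hlt e ⟨hr.2.le, h⟩) (not_lt.2 hpos.le)
    have := hmax b ⟨hb, (hap.trans hr.1.le).trans_lt hrb, hbe⟩
    linarith [hr.1]
  rcases (negativeRight T y c ∩ Ioc a e).eq_empty_or_nonempty with h | h
  · exact key a le_rfl hae.le (by simp [h]) hqa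
  · obtain ⟨b, hb, hmax⟩ := hfin.exists_maximalFor id _ h
    refine key b hb.2.1.le hb.2.2 (fun b' hb' => ?_) (hno b hb.1 hb.2)
    by_contra! hlt
    exact absurd (hmax hb' hlt.le) (not_le.2 hlt)

/-- `w 1 < … < w M` enumerates the left endpoints of the positive sets. -/
structure IsEnumeration (T : ℝ) (y c : ℝ → ℝ) (M : ℕ) (w : ℕ → ℝ) : Prop where
  strictMonoOn : StrictMonoOn w (Icc 1 M)
  image_eq : w '' Icc 1 M = positiveLeft T y c

namespace IsEnumeration

variable {M : ℕ} {w : ℕ → ℝ}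

theorem mem (h : IsEnumeration T y c M w) {k : ℕ} (h1 : 1 ≤ k) (hM : k ≤ M) :
    w k ∈ positiveLeft T y c := h.image_eq ▸ mem_image_of_mem w ⟨h1, hM⟩

theorem lt_succ (h : IsEnumeration T y c M w) {k : ℕ} (h1 : 1 ≤ k) (hM : k + 1 ≤ M) :
    w k < w (k + 1) :=
  h.strictMonoOn ⟨h1, by omega⟩ ⟨by omega, hM⟩ (Nat.lt_succ_self k)

theorem notMem_Ioo (h : IsEnumeration T y c M w) {k : ℕ} (h1 : 1 ≤ k) (hM : k + 1 ≤ M) :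
    ∀ p ∈ positiveLeft T y c, p ∉ Ioo (w k) (w (k + 1)) := by
  intro p hp hpI
  rw [← h.image_eq] at hp
  obtain ⟨l, hl, rfl⟩ := hp
  have h2 := (h.strictMonoOn.lt_iff_lt ⟨h1, by omega⟩ hl).1 hpI.1
  have h3 := (h.strictMonoOn.lt_iff_lt hl ⟨by omega, hM⟩).1 hpI.2
  omega

theorem first_le (h : IsEnumeration T y c M w) : ∀ p ∈ positiveLeft T y c, w 1 ≤ p := by
  intro p hp
  rw [← h.image_eq] at hp
  obtain ⟨l, hl, rfl⟩ := hp
  exact h.strictMonoOn.monotoneOn ⟨le_rfl, hl.1.trans hl.2⟩ hl hl.1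

theorem le_last (h : IsEnumeration T y c M w) : ∀ p ∈ positiveLeft T y c, p ≤ w M := by
  intro p hp
  rw [← h.image_eq] at hp
  obtain ⟨l, hl, rfl⟩ := hp
  exact h.strictMonoOn.monotoneOn hl ⟨hl.1.trans hl.2, le_rfl⟩ hl.2

/-- As long as there is no transition after the `r`-th positive set, the cumulative net inflow does
not fall below its value at the start of this set. -/
theorem integral_nonneg_of_forall_notMem (h : IsEnumeration T y c M w) (hy : IsStep y)
    (hc : IsStep c) {r : ℕ} (hr1 : 1 ≤ r)
    (hmin : ∀ s ∈ Icc 0 (w r), 0 ≤ ∫ t in (w r)..s, (y t - c t)) {k : ℕ} (hrk : r ≤ k)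
    (hkM : k ≤ M) (hno : ∀ l, r < l → l ≤ k → l ∉ candidates T y c M w r) :
    ∀ s ∈ Icc 0 (w k), 0 ≤ ∫ t in (w r)..s, (y t - c t) := by
  have hi := (IsStep.comp₂ (· - ·) hy hc).intervalIntegrable
  induction k, hrk using Nat.le_induction with
  | base => exact hmin
  | succ k hrk ih =>
    have ih := ih (by omega) fun l h1 h2 => hno l h1 (by omega)
    have hk1 : 1 ≤ k := hr1.trans hrk
    have hwk := mem_Ico_of_mem_positiveLeft (h.mem hk1 (by omega))
    have hwk' := mem_Ico_of_mem_positiveLeft (h.mem (by omega) hkM)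
    have hlt := h.lt_succ hk1 hkM
    have hk : 0 ≤ ∫ t in (w r)..(w k), (y t - c t) := ih (w k) ⟨hwk.1, le_rfl⟩
    have hk' : 0 ≤ ∫ t in (w r)..(w (k + 1)), (y t - c t) := by
      refine integral_nonneg_of_forall_negativeRight hy hc hwk.1 hlt hwk'.2
        (lt_of_mem_positiveLeft hy hc (h.mem (by omega) hkM)) hk fun b hb hbI => ?_
      -- A strict deficit at `b` meets the test for candidates both when `b` lies before `w (k + 1)`
      -- and when it equals it, so `k + 1` would be a candidate.
      by_contra! hneg
      rw [intervalIntegral.integral_sub (hy.intervalIntegrable _ _) (hc.intervalIntegrable _ _)]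
        at hneg
      refine hno (k + 1) (by omega) le_rfl ⟨by omega, hkM, b, hb, hbI, ?_⟩
      rcases hbI.2.lt_or_eq with h' | h'
      · exact Or.inl ⟨h', by linarith⟩
      · exact Or.inr ⟨h', by linarith⟩
    intro s hs
    rcases le_or_gt s (w k) with hsk | hsk
    · exact ih s ⟨hs.1, hsk⟩
    -- Between consecutive left endpoints the cumulative net inflow first rises and then does not
    -- rise, so its value at `s` is at least the smaller of the two endpoint values.
    · rcases forall_lt_or_integral_nonpos hy hc hwk.1 hsk hs.2 hwk'.2.le (h.notMem_Ioo hk1 hkM)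
        with h' | h'
      · rw [← intervalIntegral.integral_add_adjacent_intervals (hi (w r) (w k)) (hi (w k) s)]
        exact add_nonneg hk
          (integral_nonneg_of_forall_Ioo hi hsk.le fun r hr => sub_nonneg.2 (h' r hr).le)
      · have := intervalIntegral.integral_add_adjacent_intervals (hi (w r) s) (hi s (w (k + 1)))
        linarith

/-- The cumulative net inflow is minimal, among all earlier times, at every transition. -/
theorem integral_nonneg_of_transition (h : IsEnumeration T y c M w) (hy : IsStep y)
    (hc : IsStep c) {r l : ℕ} (hr1 : 1 ≤ r)
    (hmin : ∀ s ∈ Icc 0 (w r), 0 ≤ ∫ t in (w r)..s, (y t - c t))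
    (hl : IsLeast (candidates T y c M w r) l) :
    ∀ s ∈ Icc 0 (w l), 0 ≤ ∫ t in (w l)..s, (y t - c t) := by
  have hi := (IsStep.comp₂ (· - ·) hy hc).intervalIntegrable
  obtain ⟨hrl, hlM, b, -, hbI, hb⟩ := hl.1
  obtain ⟨k, rfl⟩ : ∃ k, l = k + 1 := ⟨l - 1, by omega⟩
  simp only [Nat.add_sub_cancel] at hbI
  have hk1 : 1 ≤ k := by omega
  have hB := h.integral_nonneg_of_forall_notMem hy hc hr1 hmin (k := k) (by omega) (by omega)
    fun j _ hjk hj => absurd (hl.2 hj) (by omega)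
  have hwk := mem_Ico_of_mem_positiveLeft (h.mem hk1 (by omega))
  have hwk' := mem_Ico_of_mem_positiveLeft (h.mem (by omega) hlM)
  have hk : 0 ≤ ∫ t in (w r)..(w k), (y t - c t) := hB (w k) ⟨hwk.1, le_rfl⟩
  have hrb : ∫ t in (w r)..b, (y t - c t) ≤ 0 := by
    rw [intervalIntegral.integral_sub (hy.intervalIntegrable _ _) (hc.intervalIntegrable _ _)]
    rcases hb with hb | hb <;> linarith [hb.2]
  -- The net inflow cannot be positive on all of `(w k, b)`: the cumulative value at `w k` is
  -- nonnegative relative to `w r`, and a strict increase would contradict `hrb`. Hence `b` lies on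
  -- the nonincreasing part, and `w (k + 1)` is at most as high as `w r`.
  have hbl : ∫ t in b..(w (k + 1)), (y t - c t) ≤ 0 := by
    rcases forall_lt_or_integral_nonpos hy hc hwk.1 hbI.1 hbI.2 hwk'.2.le (h.notMem_Ioo hk1 hlM)
      with h' | h'
    · have h2 : 0 < ∫ t in (w k)..b, (y t - c t) :=
        intervalIntegral.intervalIntegral_pos_of_pos_on (hi _ _)
          (fun r hr => sub_pos.2 (h' r hr)) hbI.1
      have h3 := intervalIntegral.integral_add_adjacent_intervals (hi (w r) (w k)) (hi (w k) b)
      linarith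
    · exact h'
  have hrl := intervalIntegral.integral_add_adjacent_intervals (hi (w r) b) (hi b (w (k + 1)))
  intro s hs
  have hrs := intervalIntegral.integral_add_adjacent_intervals
    (hi (w r) (w (k + 1))) (hi (w (k + 1)) s)
  rcases le_or_gt s (w k) with hsk | hsk
  · have := hB s ⟨hs.1, hsk⟩
    linarith
  · rcases forall_lt_or_integral_nonpos hy hc hwk.1 hsk hs.2 hwk'.2.le (h.notMem_Ioo hk1 hlM)
      with h' | h'
    · have h2 := integral_nonneg_of_forall_Ioo hi hsk.le fun r hr => sub_nonneg.2 (h' r hr).le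
      have h3 := intervalIntegral.integral_add_adjacent_intervals (hi (w r) (w k)) (hi (w k) s)
      linarith
    · rw [intervalIntegral.integral_symm]
      linarith

end IsEnumeration

/-- By induction along the transitions, each `w (r j)` minimises the cumulative net inflow over all
earlier times. Since `r m` has no candidate, no later value up to `w M` is smaller. After `w M` the
net inflow is positive for a while and nonpositive afterwards. So, as start of a window ending at
`T`, a time `s` loses either to `α` or to the empty window. -/
theorem IsLastTransition.exists_nonneg (hy : IsStep y) (hc : IsStep c) {α : ℝ}
    (h : IsLastTransition T y c α) : α ∈ Icc 0 T ∧ ∀ s ∈ Icc 0 T,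
      0 ≤ ∫ t in α..s, (y t - c t) ∨ ∫ t in s..T, (y t - c t) ≤ 0 := by
  have hi := (IsStep.comp₂ (· - ·) hy hc).intervalIntegrable
  obtain ⟨M, w, m, r, hM, hmono, himg, hm, hr1, hleast, hempty, rfl⟩ := h
  have hw : IsEnumeration T y c M w := ⟨hmono, himg⟩
  have hind : ∀ j, 1 ≤ j → j ≤ m → 1 ≤ r j ∧ r j ≤ M ∧
      ∀ s ∈ Icc 0 (w (r j)), 0 ≤ ∫ t in (w (r j))..s, (y t - c t) := by
    intro j hj
    induction j, hj using Nat.le_induction with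
    | base =>
      intro _
      rw [hr1]
      refine ⟨le_rfl, hM, fun s hs => ?_⟩
      rw [intervalIntegral.integral_symm, neg_nonneg]
      refine integral_nonpos_of_forall_Ioo hi hs.2 fun t ht => ?_
      by_contra! hpos
      have h1T := (mem_Ico_of_mem_positiveLeft (hw.mem le_rfl hM)).2
      obtain ⟨p, hp, hpt, -⟩ := exists_mem_positiveLeft (T := T) hy hc
        (t := t) ⟨hs.1.trans ht.1.le, ht.2.trans h1T⟩ (sub_pos.1 hpos)
      linarith [hw.first_le p hp, ht.2]
    | succ j hj ih =>
      intro hjm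
      obtain ⟨h1, -, h2⟩ := ih (by omega)
      have hl := hleast (j + 1) ⟨by omega, hjm⟩
      simp only [Nat.add_sub_cancel] at hl
      exact ⟨by have := hl.1.1; omega, hl.1.2.1, hw.integral_nonneg_of_transition hy hc h1 h2 hl⟩
  obtain ⟨h1, h2, h3⟩ := hind m hm le_rfl
  have hα := mem_Ico_of_mem_positiveLeft (hw.mem h1 h2)
  refine ⟨⟨hα.1, hα.2.le⟩, fun s hs => ?_⟩
  have hB := hw.integral_nonneg_of_forall_notMem hy hc h1 h3 h2 le_rfl fun l _ _ => by
    rw [hempty]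
    exact notMem_empty l
  rcases le_or_gt s (w M) with hsM | hsM
  · exact Or.inl (hB s ⟨hs.1, hsM⟩)
  · have hwM := mem_Ico_of_mem_positiveLeft (hw.mem hM le_rfl)
    rcases forall_lt_or_integral_nonpos (T := T) hy hc hwM.1 hsM hs.2 le_rfl
      (fun p hp hpI => absurd (hw.le_last p hp) (not_le.2 hpI.1)) with h' | h'
    · left
      rw [← intervalIntegral.integral_add_adjacent_intervals (hi _ (w M)) (hi (w M) s)]
      exact add_nonneg (hB _ ⟨hwM.1, le_rfl⟩)
        (integral_nonneg_of_forall_Ioo hi hsM.le fun r hr => sub_nonneg.2 (h' r hr).le)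
    · exact Or.inr h'

/-- The initial queue length of the single-link algorithm is the value at `0` of the periodic
queue. -/
theorem IsInitialQueue.eq_periodicQueue (hT : 0 < T) (hy : IsStep y) (hc : IsStep c)
    (hyp : Function.Periodic y T) (hcp : Function.Periodic c T) {q : ℝ}
    (h : IsInitialQueue T y c q) : q = periodicQueue T (fun r => y r - c r) 0 := by
  have hi := (IsStep.comp₂ (· - ·) hy hc).intervalIntegrable
  have hper : Function.Periodic (fun r => y r - c r) T := fun r => by simp only [hyp r, hcp r]
  -- Evaluating at `T` instead of `0` makes the window `[0, T]`, the period on which the algorithm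
  -- works.
  have hQ : periodicQueue T (fun r => y r - c r) 0 = periodicQueue T (fun r => y r - c r) T := by
    have := periodicQueue_periodic hper 0
    rw [← this, zero_add]
  obtain ⟨s, hs, hsQ⟩ := exists_periodicQueue_eq hT hi T
  have hQn := periodicQueue_nonneg hT hi T
  rw [sub_self] at hs
  rw [hQ]
  rcases h with ⟨hempty, rfl⟩ | ⟨α, hα, rfl⟩
  · refine le_antisymm hQn (hsQ.trans_le (integral_nonpos_of_forall_Ioo hi hs.2 fun t ht => ?_))
    by_contra! hpos
    obtain ⟨p, hp, -⟩ := exists_mem_positiveLeft (T := T) hy hc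
      (t := t) ⟨hs.1.trans ht.1.le, ht.2⟩ (sub_pos.1 hpos)
    exact notMem_empty p (hempty ▸ hp)
  · obtain ⟨hαT, hmin⟩ := hα.exists_nonneg hy hc
    rw [← intervalIntegral.integral_sub (hy.intervalIntegrable _ _) (hc.intervalIntegrable _ _)]
    apply le_antisymm
    · exact max_le (integral_le_periodicQueue_of_mem hi (by simpa using hαT)) hQn
    · rw [hsQ]
      rcases hmin s hs with h' | h'
      · refine le_max_of_le_left ?_
        have := intervalIntegral.integral_add_adjacent_intervals (hi α s) (hi s T)
        linarith
      · exact le_max_of_le_right h'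

theorem exists_isEnumeration (hy : IsStep y) (hc : IsStep c)
    (hne : (positiveLeft T y c).Nonempty) : ∃ M w, 1 ≤ M ∧ IsEnumeration T y c M w := by
  obtain ⟨S, hS⟩ := (finite_positiveLeft (T := T) hy hc).exists_finset_coe
  have hcard : 0 < S.card := by
    rw [Finset.card_pos, ← Finset.coe_nonempty, hS]
    exact hne
  let e := S.orderEmbOfFin rfl
  -- The enumeration counts from `1` and `Fin` from `0`, hence `k - 1`; the value `0` outside the
  -- range is never used.
  refine ⟨S.card, fun k => if h : k - 1 < S.card then e ⟨k - 1, h⟩ else 0, hcard, ?_, ?_⟩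
  · intro a ha b hb hab
    have ha' : a - 1 < S.card := by have := ha.1; have := ha.2; omega
    have hb' : b - 1 < S.card := by have := hb.1; have := hb.2; omega
    simp only [ha', hb', dif_pos]
    refine e.strictMono (Fin.mk_lt_mk.2 ?_)
    have := ha.1
    omega
  · ext p
    rw [← hS]
    constructor
    · rintro ⟨k, hk, rfl⟩
      have hk' : k - 1 < S.card := by have := hk.1; have := hk.2; omega
      simp only [hk', dif_pos]
      exact S.orderEmbOfFin_mem rfl _
    · intro hp
      rw [← S.range_orderEmbOfFin rfl] at hp
      obtain ⟨⟨k, hk⟩, rfl⟩ := hp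
      refine ⟨k + 1, ⟨by omega, hk⟩, ?_⟩
      simp [hk, e]

/-- A candidate exceeds the current index and is at most `M`, so the greedy choice stops; `n` bounds
the number of choices left when the chain starts from an arbitrary index `q`. -/
theorem exists_transitions (T : ℝ) (y c : ℝ → ℝ) (M : ℕ) (w : ℕ → ℝ) (n : ℕ) :
    ∀ q, M ≤ q + n → ∃ (m : ℕ) (r : ℕ → ℕ), 1 ≤ m ∧ r 1 = q ∧
      (∀ j ∈ Icc 2 m, IsLeast (candidates T y c M w (r (j - 1))) (r j)) ∧
      candidates T y c M w (r m) = ∅ := by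
  induction n with
  | zero =>
    intro q hq
    refine ⟨1, fun _ => q, le_rfl, rfl, fun j hj => absurd (hj.1.trans hj.2) (by omega), ?_⟩
    refine eq_empty_of_forall_notMem fun l hl => ?_
    have h1 : q + 1 ≤ l := hl.1
    have h2 := hl.2.1
    omega
  | succ n ih =>
    intro q hq
    rcases (candidates T y c M w q).eq_empty_or_nonempty with h | h
    · exact ⟨1, fun _ => q, le_rfl, rfl, fun j hj => absurd (hj.1.trans hj.2) (by omega), h⟩
    · have hl : IsLeast (candidates T y c M w q) (sInf (candidates T y c M w q)) :=
        ⟨Nat.sInf_mem h, fun _ hk => Nat.sInf_le hk⟩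
      obtain ⟨m, r, hm, hr1, hr, hempty⟩ := ih (sInf (candidates T y c M w q))
        (by have := hl.1.1; omega)
      refine ⟨m + 1, fun j => if j ≤ 1 then q else r (j - 1), by omega, by simp, ?_, ?_⟩
      · intro j hj
        have h2 := hj.1
        have h3 := hj.2
        rcases h2.eq_or_lt with rfl | h2'
        · simpa [hr1] using hl
        · have := hr (j - 1) ⟨by omega, by omega⟩
          simpa [show ¬ j ≤ 1 by omega, show ¬ j - 1 ≤ 1 by omega] using this
      · simpa [show m ≠ 0 by omega] using hempty

theorem exists_isInitialQueue (hy : IsStep y) (hc : IsStep c) : ∃ q, IsInitialQueue T y c q := by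
  rcases (positiveLeft T y c).eq_empty_or_nonempty with h | h
  · exact ⟨0, Or.inl ⟨h, rfl⟩⟩
  · obtain ⟨M, w, hM, hw⟩ := exists_isEnumeration hy hc h
    obtain ⟨m, r, hm, hr1, hr, hempty⟩ := exists_transitions T y c M w M 1 (by omega)
    exact ⟨_, Or.inr ⟨w (r m), ⟨M, w, m, r, hM, hw.strictMonoOn, hw.image_eq, hm, hr1, hr, hempty,
      rfl⟩, rfl⟩⟩

/-- The single-link algorithm outputs the periodic queue and the corresponding outflow. -/
theorem isSingleLinkOutput_iff (hT : 0 < T) (hy : IsStep y) (hc : IsStep c)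
    (hyp : Function.Periodic y T) (hcp : Function.Periodic c T)
    (hneg : ∫ r in (0 : ℝ)..T, (y r - c r) ≤ 0) {x z : ℝ → ℝ} :
    IsSingleLinkOutput T y c x z ↔ x = periodicQueue T (fun r => y r - c r) ∧
      z = fun t => linkOutflow (periodicQueue T (fun r => y r - c r) t) (y t) (c t) := by
  have hi := (IsStep.comp₂ (· - ·) hy hc).intervalIntegrable
  have hper : Function.Periodic (fun r => y r - c r) T := fun r => by simp only [hyp r, hcp r]
  have hQp := periodicQueue_periodic hper
  have hzp : Function.Periodic
      (fun t => linkOutflow (periodicQueue T (fun r => y r - c r) t) (y t) (c t)) T := fun t => by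
    simp only [hQp t, hyp t, hcp t]
  have hext : ∀ {f g : ℝ → ℝ}, Function.Periodic f T → Function.Periodic g T →
      (∀ t ∈ Icc 0 T, f t = g t) → f = g := by
    intro f g hf hg h
    funext t
    have hfg : Function.Periodic (fun r => f r - g r) T := fun r => by simp only [hf r, hg r]
    obtain ⟨s, hs, hst⟩ := hfg.exists_mem_Ico₀ hT t
    simp only [h s ⟨hs.1, hs.2.le⟩, sub_self] at hst
    exact sub_eq_zero.1 hst
  constructor
  · intro h
    have hx : ∀ t ∈ Icc 0 T, x t = periodicQueue T (fun r => y r - c r) t :=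
      queue_eq_periodicQueue hT hy.intervalIntegrable hc.intervalIntegrable hyp hcp hneg
        (h.initial.eq_periodicQueue hT hy hc hyp hcp) h.queue_nonneg h.integrable h.outflow h.queue
    refine ⟨hext h.queue_periodic hQp hx, hext h.outflow_periodic hzp fun t ht => ?_⟩
    rw [h.outflow t ht, hx t ht]
  · rintro ⟨rfl, rfl⟩
    obtain ⟨q, hq⟩ := exists_isInitialQueue (T := T) hy hc
    exact {
      queue_periodic := hQp
      outflow_periodic := hzp
      initial := hq.eq_periodicQueue hT hy hc hyp hcp ▸ hq
      queue_nonneg := fun t _ => periodicQueue_nonneg hT hi t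
      integrable := (IsStep.outflow hT hy hc hyp hcp hneg).intervalIntegrable 0 T
      outflow := fun _ _ => rfl
      queue := fun t ht => periodicQueue_eq_add_integral hT hy hc hyp hcp hneg ht.1 }

end InitialQueue

/-! ## Weights that certify stability -/

section Weights

variable {E : Type*} [Fintype E] {R : Matrix E E ℝ}

/-- A positive vector that the routing matrix contracts strictly. -/
structure IsContractionWeight (R : Matrix E E ℝ) (ε : ℝ) (v : E → ℝ) : Prop where
  eps_pos : 0 < ε
  pos : ∀ i, 0 < v i
  sum_add_le : ∀ i, ∑ j, R j i * v j + ε ≤ v i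

/-- Maximum principle: let `k` maximise `e / v`, with maximum `ρ`. If `ρ > 0`, then `e k ≤ ρ * ∑ j,
R j k * v j < ρ * v k = e k`. -/
theorem IsContractionWeight.nonpos_of_le_sum {ε : ℝ} {v : E → ℝ} (hv : IsContractionWeight R ε v)
    (hR : ∀ j i, 0 ≤ R j i) {e : E → ℝ} (he : ∀ i, e i ≤ ∑ j, R j i * e j) (i : E) : e i ≤ 0 := by
  have : Nonempty E := ⟨i⟩
  obtain ⟨k, -, hk⟩ := Finset.exists_max_image Finset.univ (fun i => e i / v i)
    Finset.univ_nonempty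
  have hle : ∀ j, e j ≤ e k / v k * v j := fun j => by
    have := hk j (Finset.mem_univ j)
    rwa [div_le_iff₀ (hv.pos j)] at this
  by_contra! hpos
  have hρ : 0 < e k / v k := (div_pos hpos (hv.pos i)).trans_le (hk i (Finset.mem_univ i))
  have h1 : ∑ j, R j k * e j ≤ e k / v k * ∑ j, R j k * v j := by
    rw [Finset.mul_sum]
    refine Finset.sum_le_sum fun j _ => ?_
    have := mul_le_mul_of_nonneg_left (hle j) (hR j k)
    linarith
  have h2 : e k / v k * ∑ j, R j k * v j < e k / v k * v k :=
    mul_lt_mul_of_pos_left (by linarith [hv.sum_add_le k, hv.eps_pos]) hρ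
  have h3 : e k / v k * v k = e k := div_mul_cancel₀ _ (hv.pos k).ne'
  linarith [he k]

/-- The multiple `K / ε * v` is a supersolution, since the margin `ε` in the contraction absorbs
`K`; the maximum principle applies to the difference. -/
theorem IsContractionWeight.le_of_le_add_sum {ε : ℝ} {v : E → ℝ} (hv : IsContractionWeight R ε v)
    (hR : ∀ j i, 0 ≤ R j i) {K : ℝ} (hK : 0 ≤ K) {e : E → ℝ}
    (he : ∀ i, e i ≤ K + ∑ j, R j i * e j) (i : E) : e i ≤ K / ε * v i := by
  have h := hv.nonpos_of_le_sum hR (e := fun i => e i - K / ε * v i) (fun i => ?_) i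
  · linarith
  have h1 : ∑ j, R j i * (e j - K / ε * v j) = ∑ j, R j i * e j - K / ε * ∑ j, R j i * v j := by
    rw [Finset.mul_sum, ← Finset.sum_sub_distrib]
    exact Finset.sum_congr rfl fun j _ => by ring
  have h2 := mul_le_mul_of_nonneg_left (hv.sum_add_le i) (div_nonneg hK hv.eps_pos.le)
  have h3 : K / ε * (∑ j, R j i * v j + ε) = K / ε * ∑ j, R j i * v j + K := by
    have := hv.eps_pos.ne'
    field_simp
  rw [h1]
  linarith [he i]

end Weights

/-! ## The linear program for the outflows -/

section LinearProgram

variable {E : Type*} [Fintype E] {R : Matrix E E ℝ}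

theorem abs_linkOutflow_sub_le {q y y' c : ℝ} :
    |linkOutflow q y c - linkOutflow q y' c| ≤ |y - y'| := by
  unfold linkOutflow
  split_ifs
  · simp
  · have := abs_min_sub_min_le_max c y c y'
    simpa using this

/-- At an optimum no coordinate lies below its own bound: raising it only relaxes the other
constraints, as `R` is nonnegative, and increases the objective. Conversely, a fixed point dominates
every feasible point in each coordinate, by the maximum principle for the positive parts of the
differences, and so it is optimal for every positive `η`. -/
theorem isOptimalOutflow_iff {ε : ℝ} {v : E → ℝ} (hv : IsContractionWeight R ε v)
    (hR : ∀ j i, 0 ≤ R j i) (δ : E → E → ℝ) {η : E → ℝ} (hη : ∀ i, 0 < η i) {q cap a ζ : E → ℝ}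
    (hq : ∀ i, 0 ≤ q i) :
    IsOptimalOutflow R δ η q cap a ζ ↔
      ∀ i, ζ i = linkOutflow (q i) (a i + ∑ j ∈ instantUpstream R δ i, R j i * ζ j) (cap i) := by
  classical
  constructor
  · rintro ⟨⟨hcap, hin⟩, hopt⟩ i
    set b := linkOutflow (q i) (a i + ∑ j ∈ instantUpstream R δ i, R j i * ζ j) (cap i) with hb
    have hle : ζ i ≤ b := by
      rcases (hq i).eq_or_lt with h | h
      · rw [hb, linkOutflow_of_nonpos h.ge]
        exact le_min (hcap i) (hin i h.symm)
      · rw [hb, linkOutflow_of_pos h]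
        exact hcap i
    refine hle.antisymm (le_of_not_gt fun hlt => ?_)
    have hmono : ∀ k, ζ k ≤ Function.update ζ i b k := fun k => by
      rcases eq_or_ne k i with rfl | hk
      · simpa using hle
      · simp [hk]
    have hsum : ∀ k, a k + ∑ j ∈ instantUpstream R δ k, R j k * ζ j ≤
        a k + ∑ j ∈ instantUpstream R δ k, R j k * Function.update ζ i b j := fun k => by
      gcongr with j _
      · exact hR j k
      · exact hmono j
    have hfeas : Function.update ζ i b ∈ FeasibleOutflows R δ q cap a := by
      refine ⟨fun k => ?_, fun k hk => ?_⟩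
      · rcases eq_or_ne k i with rfl | hki
        · simpa [hb] using linkOutflow_le
        · simpa [hki] using hcap k
      · refine le_trans ?_ (hsum k)
        rcases eq_or_ne k i with rfl | hki
        · rw [Function.update_self, hb, linkOutflow_of_nonpos hk.le]
          exact min_le_right _ _
        · simpa [hki] using hin k hk
    refine absurd (hopt _ hfeas) (not_le.2 (Finset.sum_lt_sum (fun k _ => ?_)
      ⟨i, Finset.mem_univ i, ?_⟩))
    · exact mul_le_mul_of_nonneg_left (hmono k) (hη k).le
    · simpa using mul_lt_mul_of_pos_left hlt (hη i)
  · intro hζ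
    refine ⟨⟨fun i => ?_, fun i hi => ?_⟩, fun ζ' hζ' => ?_⟩
    · rw [hζ i]
      exact linkOutflow_le
    · conv_lhs => rw [hζ i, linkOutflow_of_nonpos hi.le]
      exact min_le_right _ _
    · have key := hv.nonpos_of_le_sum hR (e := fun i => max (ζ' i - ζ i) 0) fun i => ?_
      · refine Finset.sum_le_sum fun i _ => mul_le_mul_of_nonneg_left ?_ (hη i).le
        have := (le_max_left _ _).trans (key i)
        linarith
      · have hnn : 0 ≤ ∑ j, R j i * max (ζ' j - ζ j) 0 :=
          Finset.sum_nonneg fun j _ => mul_nonneg (hR j i) (le_max_right _ _)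
        refine max_le ?_ hnn
        rcases (hq i).eq_or_lt with h | h
        · have h1 := hζ i
          rw [linkOutflow_of_nonpos h.ge] at h1
          rcases min_choice (cap i) (a i + ∑ j ∈ instantUpstream R δ i, R j i * ζ j) with h2 | h2
          · rw [h2] at h1
            linarith [hζ'.1 i]
          · rw [h2] at h1
            have h3 := hζ'.2 i h.symm
            have h4 : ∑ j ∈ instantUpstream R δ i, R j i * ζ' j -
                ∑ j ∈ instantUpstream R δ i, R j i * ζ j ≤
                ∑ j, R j i * max (ζ' j - ζ j) 0 := by
              rw [← Finset.sum_sub_distrib]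
              calc _ ≤ ∑ j ∈ instantUpstream R δ i, R j i * max (ζ' j - ζ j) 0 := by
                    refine Finset.sum_le_sum fun j _ => ?_
                    rw [← mul_sub]
                    exact mul_le_mul_of_nonneg_left (le_max_left _ _) (hR j i)
                _ ≤ _ := Finset.sum_le_univ_sum_of_nonneg
                    fun j => mul_nonneg (hR j i) (le_max_right _ _)
            linarith
        · have h1 := hζ i
          rw [linkOutflow_of_pos h] at h1
          linarith [hζ'.1 i]

theorem delayedInflow_add_sum (R : Matrix E E ℝ) (δ : E → E → ℝ) (lam z : E → ℝ → ℝ) (i : E)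
    (t : ℝ) : delayedInflow R δ lam z i t + ∑ j ∈ instantUpstream R δ i, R j i * z j t =
      inflow R δ lam z i t := by
  have h : ∑ j ∈ instantUpstream R δ i, R j i * z j t =
      ∑ j ∈ instantUpstream R δ i, R j i * z j (t - δ j i) :=
    Finset.sum_congr rfl fun j hj => by
      rw [instantUpstream, Finset.mem_filter] at hj
      rw [hj.2.2, sub_zero]
  unfold delayedInflow inflow
  rw [h, instantUpstream, add_assoc, add_comm (∑ j ∈ Finset.univ.filter _, _),
    Finset.sum_filter_add_sum_filter_not]

end LinearProgram

/-! ## A comparison principle for the absolute value of an integral -/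

theorem AbsolutelyContinuousOnInterval.abs {f : ℝ → ℝ} {a b : ℝ}
    (hf : AbsolutelyContinuousOnInterval f a b) :
    AbsolutelyContinuousOnInterval (fun t => |f t|) a b :=
  squeeze_zero (fun _ => Finset.sum_nonneg fun _ _ => dist_nonneg)
    (fun _ => Finset.sum_le_sum fun _ _ => by
      simpa only [Real.dist_eq] using abs_abs_sub_abs_le_abs_sub _ _) hf

/-- If `f` has the rate of change `g`, and `h` bounds the rate of change of `|f|` away from the
zeros of `f` and is nonnegative at these zeros, then `|f|` grows at most by the integral of `h`. -/
theorem abs_le_abs_add_integral {f g h : ℝ → ℝ} {b : ℝ} (hb : 0 ≤ b)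
    (hg : IntervalIntegrable g volume 0 b) (hh : IntervalIntegrable h volume 0 b)
    (hf : ∀ t ∈ Icc 0 b, f t = f 0 + ∫ s in (0 : ℝ)..t, g s)
    (hpos : ∀ t ∈ Icc 0 b, 0 < f t → g t ≤ h t) (hneg : ∀ t ∈ Icc 0 b, f t < 0 → -g t ≤ h t)
    (hzero : ∀ t ∈ Icc 0 b, f t = 0 → 0 ≤ h t) :
    |f b| ≤ |f 0| + ∫ s in (0 : ℝ)..b, h s := by
  set F : ℝ → ℝ := fun t => f 0 + ∫ s in (0 : ℝ)..t, g s with hF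
  have h0 : (0 : ℝ) ∈ uIcc 0 b := left_mem_uIcc
  have hint : AbsolutelyContinuousOnInterval (fun t => ∫ s in (0 : ℝ)..t, g s) 0 b :=
    hg.absolutelyContinuousOnInterval_intervalIntegral h0
  have hFac : AbsolutelyContinuousOnInterval F 0 b :=
    AbsolutelyContinuousOnInterval.add (by simp [AbsolutelyContinuousOnInterval,
      tendsto_const_nhds]) hint
  have hAac := AbsolutelyContinuousOnInterval.abs hFac
  have hder := hAac.integral_deriv_eq_sub
  have hFb : F b = f b := (hf b ⟨hb, le_rfl⟩).symm
  have hF0 : F 0 = f 0 := (hf 0 ⟨le_rfl, hb⟩).symm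
  have hle : ∫ t in (0 : ℝ)..b, deriv (fun t => |F t|) t ≤ ∫ t in (0 : ℝ)..b, h t := by
    refine intervalIntegral.integral_mono_ae_restrict hb hAac.intervalIntegrable_deriv hh ?_
    rw [EventuallyLE, ae_restrict_iff' measurableSet_Icc]
    filter_upwards [hg.ae_hasDerivAt_integral] with t ht htI
    have hd : HasDerivAt F (g t) t :=
      (ht (by rwa [uIcc_of_le hb]) 0 h0).const_add (f 0)
    have hFt : F t = f t := (hf t htI).symm
    rcases lt_trichotomy (f t) 0 with h' | h' | h'
    · have hd' := (hasDerivAt_abs_neg (hFt ▸ h')).comp t hd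
      have : deriv (fun t => |F t|) t = -1 * g t := hd'.deriv
      rw [this]
      linarith [hneg t htI h']
    -- At a zero of `f` the absolute value has a minimum, so `deriv` is `0` there, whether or not
    -- the derivative exists.
    · have hmin : IsLocalMin (fun t => |F t|) t := Eventually.of_forall fun s => by
        simp only [hFt, h', abs_zero, abs_nonneg]
      rw [hmin.deriv_eq_zero]
      exact hzero t htI h'
    · have hd' := (hasDerivAt_abs_pos (hFt ▸ h')).comp t hd
      have : deriv (fun t => |F t|) t = 1 * g t := hd'.deriv
      rw [this]
      linarith [hpos t htI h']
  simp only [hFb, hF0] at hder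
  linarith

/-! ## Contraction of the network dynamics -/

section Contraction

theorem maxDelay_nonneg {E : Type*} {R : Matrix E E ℝ} {δ : E → E → ℝ}
    (hδ : ∀ j i, 0 ≤ δ j i) : 0 ≤ maxDelay R δ :=
  Real.iSup_nonneg fun p => by
    split_ifs
    · exact hδ _ _
    · exact le_rfl

variable {E : Type*} [Fintype E] {R : Matrix E E ℝ} {δ : E → E → ℝ} {lam c : E → ℝ → ℝ}

/-- The network dynamics for `t ≥ 0`, with the linear program replaced by its solution. -/
structure IsSolution (R : Matrix E E ℝ) (δ : E → E → ℝ) (lam c : E → ℝ → ℝ)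
    (x z : E → ℝ → ℝ) : Prop where
  queue_nonneg : ∀ i, ∀ t, 0 ≤ t → 0 ≤ x i t
  integrable : ∀ i, ∀ t, 0 ≤ t → IntervalIntegrable (z i) volume (-maxDelay R δ) t
  outflow : ∀ i, ∀ t, 0 ≤ t → z i t = linkOutflow (x i t) (inflow R δ lam z i t) (c i t)
  queue : ∀ i, ∀ t, 0 ≤ t →
    x i t = x i 0 + ∫ s in (0 : ℝ)..t, (inflow R δ lam z i s - z i s)

/-- The sign of the history is split off because the comparison of two solutions does not involve
it; it matters only for the sign of later outflows. -/
theorem isTrajectory_iff {ε : ℝ} {v : E → ℝ} (hv : IsContractionWeight R ε v)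
    (hR : ∀ j i, 0 ≤ R j i) {η : E → ℝ} (hη : ∀ i, 0 < η i) {x z : E → ℝ → ℝ} :
    IsTrajectory R δ lam c η x z ↔ IsSolution R δ lam c x z ∧
      ∀ i, ∀ t, -maxDelay R δ ≤ t → t < 0 → 0 ≤ z i t := by
  constructor
  · intro h
    refine ⟨⟨h.queue_nonneg, h.integrable, fun i t ht => ?_, fun i t ht => ?_⟩, h.history_nonneg⟩
    · have := (isOptimalOutflow_iff hv hR δ hη (fun i => h.queue_nonneg i t ht)).1 (h.outflow t ht) i
      rwa [delayedInflow_add_sum] at this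
    · have := h.queue i t ht
      simpa only [delayedInflow_add_sum] using this
  · rintro ⟨h, hist⟩
    refine ⟨h.queue_nonneg, hist, h.integrable, fun t ht => ?_, fun i t ht => ?_⟩
    · refine (isOptimalOutflow_iff hv hR δ hη (fun i => h.queue_nonneg i t ht)).2 fun i => ?_
      rw [delayedInflow_add_sum]
      exact h.outflow i t ht
    · have := h.queue i t ht
      simpa only [delayedInflow_add_sum] using this

theorem le_maxDelay {j i : E} (h : 0 < R j i) : δ j i ≤ maxDelay R δ := by
  have := le_ciSup (f := fun p : E × E => if 0 < R p.1 p.2 then δ p.1 p.2 else 0)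
    (finite_range _).bddAbove (j, i)
  simp only [if_pos h] at this
  exact this

theorem intervalIntegrable_routed (hR : ∀ j i, 0 ≤ R j i) (hδ : ∀ j i, 0 ≤ δ j i) {f : ℝ → ℝ}
    {t : ℝ} (ht : 0 ≤ t) (hf : IntervalIntegrable f volume (-maxDelay R δ) t) (j i : E) :
    IntervalIntegrable (fun s => R j i * f (s - δ j i)) volume 0 t := by
  rcases (hR j i).eq_or_lt with h | h
  · simp [← h]
  · have hm := le_maxDelay (δ := δ) h
    have h1 : IntervalIntegrable f volume (0 - δ j i) (t - δ j i) := by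
      refine hf.mono_set ?_
      rw [uIcc_of_le (by linarith), uIcc_of_le (by linarith [hδ j i])]
      exact Icc_subset_Icc (by linarith) (by linarith [hδ j i])
    have h2 := h1.comp_sub_right (δ j i)
    simp only [sub_add_cancel] at h2
    exact h2.const_mul _

theorem intervalIntegrable_inflow (hR : ∀ j i, 0 ≤ R j i) (hδ : ∀ j i, 0 ≤ δ j i)
    (hlam : ∀ i a b, IntervalIntegrable (lam i) volume a b) {z : E → ℝ → ℝ} {t : ℝ} (ht : 0 ≤ t)
    (hz : ∀ i, IntervalIntegrable (z i) volume (-maxDelay R δ) t) (i : E) :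
    IntervalIntegrable (inflow R δ lam z i) volume 0 t := by
  have h := IntervalIntegrable.sum Finset.univ
    fun j _ => intervalIntegrable_routed hR hδ ht (hz j) j i
  refine ((hlam i 0 t).add h).congr (fun s _ => ?_)
  simp [inflow]

/-- The shifted interval `[-δ j i, t - δ j i]` lies in `[-maxDelay R δ, t]`. Pairs with `R j i = 0`
are treated apart, since their travel times may exceed `maxDelay`. -/
theorem integral_routed_le (hR : ∀ j i, 0 ≤ R j i) (hδ : ∀ j i, 0 ≤ δ j i) {f : ℝ → ℝ}
    {t : ℝ} (ht : 0 ≤ t) (hf : IntervalIntegrable f volume (-maxDelay R δ) t)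
    (hnn : ∀ s, 0 ≤ f s) (j i : E) :
    ∫ s in (0 : ℝ)..t, R j i * f (s - δ j i) ≤
      R j i * ((∫ s in (-maxDelay R δ)..0, f s) + ∫ s in (0 : ℝ)..t, f s) := by
  rw [intervalIntegral.integral_const_mul]
  rcases (hR j i).eq_or_lt with h | h
  · simp [← h]
  · refine mul_le_mul_of_nonneg_left ?_ (hR j i)
    have hm := le_maxDelay (δ := δ) h
    have hm0 := maxDelay_nonneg (R := R) hδ
    have hsub : ∀ a b, -maxDelay R δ ≤ a → a ≤ b → b ≤ t → IntervalIntegrable f volume a b := by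
      intro a b h1 h2 h3
      refine hf.mono_set ?_
      rw [uIcc_of_le h2, uIcc_of_le (by linarith)]
      exact Icc_subset_Icc h1 h3
    rw [intervalIntegral.integral_comp_sub_right f (δ j i),
      intervalIntegral.integral_add_adjacent_intervals (hsub _ _ le_rfl (by linarith) ht)
        (hsub _ _ (by linarith) ht le_rfl)]
    exact intervalIntegral.integral_mono_interval (by linarith) (by linarith)
      (by linarith [hδ j i]) (ae_of_all _ hnn) hf

variable {x z x' z' : E → ℝ → ℝ}

theorem abs_inflow_sub_le (hR : ∀ j i, 0 ≤ R j i) (i : E) (t : ℝ) :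
    |inflow R δ lam z i t - inflow R δ lam z' i t| ≤
      ∑ j, R j i * |z j (t - δ j i) - z' j (t - δ j i)| := by
  have : inflow R δ lam z i t - inflow R δ lam z' i t =
      ∑ j, R j i * (z j (t - δ j i) - z' j (t - δ j i)) := by
    simp only [inflow, mul_sub, Finset.sum_sub_distrib]
    ring
  rw [this]
  refine (Finset.abs_sum_le_sum_abs _ _).trans (Finset.sum_le_sum fun j _ => ?_)
  rw [abs_mul, abs_of_nonneg (hR j i)]

namespace IsSolution

/-- The rate of |x - x'| is at most |y - y'| - |z - z'|, with y and y' the inflows. The longer queue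
is positive, so its link discharges at capacity and has the larger outflow: the difference of
outflows then counts against the gap with its full absolute value. For equal queues the outflow is
1-Lipschitz in the inflow. -/
theorem abs_sub_add_integral_le (h : IsSolution R δ lam c x z) (h' : IsSolution R δ lam c x' z')
    (hR : ∀ j i, 0 ≤ R j i) (hδ : ∀ j i, 0 ≤ δ j i)
    (hlam : ∀ i a b, IntervalIntegrable (lam i) volume a b) (i : E) {t : ℝ} (ht : 0 ≤ t) :
    |x i t - x' i t| + ∫ s in (0 : ℝ)..t, |z i s - z' i s| ≤
      |x i 0 - x' i 0| +
        ∫ s in (0 : ℝ)..t, |inflow R δ lam z i s - inflow R δ lam z' i s| := by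
  have hm0 := maxDelay_nonneg (R := R) hδ
  have hz0 : ∀ {x z}, IsSolution R δ lam c x z → IntervalIntegrable (z i) volume 0 t := by
    intro x z h
    refine (h.integrable i t ht).mono_set ?_
    rw [uIcc_of_le ht, uIcc_of_le (by linarith)]
    exact Icc_subset_Icc (by linarith) le_rfl
  have hy := intervalIntegrable_inflow hR hδ hlam ht (fun j => h.integrable j t ht) i
  have hy' := intervalIntegrable_inflow hR hδ hlam ht (fun j => h'.integrable j t ht) i
  have hΔz := ((hz0 h).sub (hz0 h')).abs
  have hΔy := (hy.sub hy').abs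
  have hg := (hy.sub (hz0 h)).sub (hy'.sub (hz0 h'))
  have hsub : ∀ s ∈ Icc 0 t, uIcc 0 s ⊆ uIcc 0 t := fun s hs => by
    rw [uIcc_of_le hs.1, uIcc_of_le ht]
    exact Icc_subset_Icc le_rfl hs.2
  have key := abs_le_abs_add_integral (f := fun s => x i s - x' i s) ht hg (hΔy.sub hΔz)
    (fun s hs => by
      rw [h.queue i s hs.1, h'.queue i s hs.1, intervalIntegral.integral_sub
        ((hy.sub (hz0 h)).mono_set (hsub s hs)) ((hy'.sub (hz0 h')).mono_set (hsub s hs))]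
      ring)
    (fun s hs hpos => by
      have h1 := h.outflow i s hs.1
      rw [linkOutflow_of_pos (by linarith [h'.queue_nonneg i s hs.1])] at h1
      have h2 : z' i s ≤ c i s := h'.outflow i s hs.1 ▸ linkOutflow_le
      have h3 := le_abs_self (inflow R δ lam z i s - inflow R δ lam z' i s)
      rw [abs_of_nonneg (show 0 ≤ z i s - z' i s by linarith)]
      linarith)
    (fun s hs hneg => by
      have h1 := h'.outflow i s hs.1
      rw [linkOutflow_of_pos (by linarith [h.queue_nonneg i s hs.1])] at h1
      have h2 : z i s ≤ c i s := h.outflow i s hs.1 ▸ linkOutflow_le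
      have h3 := neg_abs_le (inflow R δ lam z i s - inflow R δ lam z' i s)
      rw [abs_of_nonpos (show z i s - z' i s ≤ 0 by linarith)]
      linarith)
    (fun s hs hzero => by
      simp only [sub_nonneg]
      rw [h.outflow i s hs.1, h'.outflow i s hs.1, sub_eq_zero.1 hzero]
      exact abs_linkOutflow_sub_le)
  rw [intervalIntegral.integral_sub hΔy hΔz] at key
  linarith

/-- Differences of inflows are routed differences of outflows, up to the contribution `A` of the
history. So the accumulated outflow differences satisfy `D i ≤ K + ∑ j, R j i * D j`, where `K`
depends only on the initial data, and the contraction bounds them uniformly in `t`. -/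
theorem exists_integral_le (h : IsSolution R δ lam c x z) (h' : IsSolution R δ lam c x' z')
    {ε : ℝ} {v : E → ℝ} (hv : IsContractionWeight R ε v)
    (hR : ∀ j i, 0 ≤ R j i) (hδ : ∀ j i, 0 ≤ δ j i)
    (hlam : ∀ i a b, IntervalIntegrable (lam i) volume a b) :
    ∃ C : E → ℝ, ∀ i t, 0 ≤ t → (∫ s in (0 : ℝ)..t, |z i s - z' i s| ≤ C i) ∧
      ∫ s in (0 : ℝ)..t, |inflow R δ lam z i s - inflow R δ lam z' i s| ≤ C i := by
  have hm0 := maxDelay_nonneg (R := R) hδ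
  have hΔ : ∀ j t, 0 ≤ t →
      IntervalIntegrable (fun s => |z j s - z' j s|) volume (-maxDelay R δ) t :=
    fun j t ht => ((h.integrable j t ht).sub (h'.integrable j t ht)).abs
  set A : E → ℝ := fun i => ∑ j, R j i * ∫ s in (-maxDelay R δ)..0, |z j s - z' j s|
  have hA : ∀ i, 0 ≤ A i := fun i => Finset.sum_nonneg fun j _ => mul_nonneg (hR j i)
    (intervalIntegral.integral_nonneg (by linarith) fun _ _ => abs_nonneg _)
  have hy : ∀ i t, 0 ≤ t → ∫ s in (0 : ℝ)..t, |inflow R δ lam z i s - inflow R δ lam z' i s| ≤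
      A i + ∑ j, R j i * ∫ s in (0 : ℝ)..t, |z j s - z' j s| := by
    intro i t ht
    have hr := fun j => intervalIntegrable_routed hR hδ ht (hΔ j t ht) j i
    have hi := ((intervalIntegrable_inflow hR hδ hlam ht (fun j => h.integrable j t ht) i).sub
      (intervalIntegrable_inflow hR hδ hlam ht (fun j => h'.integrable j t ht) i)).abs
    calc ∫ s in (0 : ℝ)..t, |inflow R δ lam z i s - inflow R δ lam z' i s|
        ≤ ∫ s in (0 : ℝ)..t, ∑ j, R j i * |z j (s - δ j i) - z' j (s - δ j i)| := by
          refine intervalIntegral.integral_mono_on ht hi ?_ fun s _ => abs_inflow_sub_le hR i s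
          refine (IntervalIntegrable.sum Finset.univ fun j _ => hr j).congr (fun s _ => ?_)
          simp
      _ = ∑ j, ∫ s in (0 : ℝ)..t, R j i * |z j (s - δ j i) - z' j (s - δ j i)| :=
          intervalIntegral.integral_finsetSum fun j _ => hr j
      _ ≤ ∑ j, R j i * ((∫ s in (-maxDelay R δ)..0, |z j s - z' j s|) +
            ∫ s in (0 : ℝ)..t, |z j s - z' j s|) :=
          Finset.sum_le_sum fun j _ =>
            integral_routed_le hR hδ ht (hΔ j t ht) (fun _ => abs_nonneg _) j i
      _ = _ := by simp only [mul_add, Finset.sum_add_distrib, A]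
  set K : ℝ := ∑ i, (|x i 0 - x' i 0| + A i)
  have hKi : ∀ i, |x i 0 - x' i 0| + A i ≤ K := fun i =>
    Finset.single_le_sum (f := fun i => |x i 0 - x' i 0| + A i)
      (fun i _ => add_nonneg (abs_nonneg _) (hA i)) (Finset.mem_univ i)
  have hK : 0 ≤ K := Finset.sum_nonneg fun i _ => add_nonneg (abs_nonneg _) (hA i)
  have hD : ∀ i t, 0 ≤ t → ∫ s in (0 : ℝ)..t, |z i s - z' i s| ≤ K / ε * v i := by
    intro i t ht
    refine hv.le_of_le_add_sum hR hK (e := fun i => ∫ s in (0 : ℝ)..t, |z i s - z' i s|)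
      (fun i => ?_) i
    have h1 := h.abs_sub_add_integral_le h' hR hδ hlam i ht
    linarith [abs_nonneg (x i t - x' i t), hy i t ht, hKi i]
  refine ⟨fun i => K / ε * v i + (A i + ∑ j, R j i * (K / ε * v j)), fun i t ht => ?_⟩
  have h1 : ∑ j, R j i * ∫ s in (0 : ℝ)..t, |z j s - z' j s| ≤ ∑ j, R j i * (K / ε * v j) :=
    Finset.sum_le_sum fun j _ => mul_le_mul_of_nonneg_left (hD j t ht) (hR j i)
  have h2 : ∀ i, 0 ≤ K / ε * v i := fun i =>
    mul_nonneg (div_nonneg hK hv.eps_pos.le) (hv.pos i).le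
  have h3 : 0 ≤ ∑ j, R j i * (K / ε * v j) :=
    Finset.sum_nonneg fun j _ => mul_nonneg (hR j i) (h2 j)
  constructor
  · linarith [hD i t ht, hA i]
  · linarith [hy i t ht, h2 i]

theorem integrableOn_Ioi (h : IsSolution R δ lam c x z) (h' : IsSolution R δ lam c x' z')
    {ε : ℝ} {v : E → ℝ} (hv : IsContractionWeight R ε v)
    (hR : ∀ j i, 0 ≤ R j i) (hδ : ∀ j i, 0 ≤ δ j i)
    (hlam : ∀ i a b, IntervalIntegrable (lam i) volume a b) (i : E) :
    IntegrableOn (fun s => z i s - z' i s) (Ioi 0) ∧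
      IntegrableOn (fun s => inflow R δ lam z i s - inflow R δ lam z' i s) (Ioi 0) := by
  have hm0 := maxDelay_nonneg (R := R) hδ
  obtain ⟨C, hC⟩ := h.exists_integral_le h' hv hR hδ hlam
  have hn : Tendsto (fun n : ℕ => (n : ℝ)) atTop atTop := tendsto_natCast_atTop_atTop
  constructor
  · refine integrableOn_Ioi_of_intervalIntegral_norm_bounded (C i) 0 (fun n => ?_) hn
      (Eventually.of_forall fun n => (hC i n n.cast_nonneg).1)
    have hi := (h.integrable i n n.cast_nonneg).sub (h'.integrable i n n.cast_nonneg)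
    exact hi.1.mono_set (Ioc_subset_Ioc (by linarith) le_rfl)
  · refine integrableOn_Ioi_of_intervalIntegral_norm_bounded (C i) 0 (fun n => ?_) hn
      (Eventually.of_forall fun n => (hC i n n.cast_nonneg).2)
    exact ((intervalIntegrable_inflow hR hδ hlam n.cast_nonneg
      (fun j => h.integrable j n n.cast_nonneg) i).sub (intervalIntegrable_inflow hR hδ hlam
      n.cast_nonneg (fun j => h'.integrable j n n.cast_nonneg) i)).1

theorem tendsto_integral_abs_sub (h : IsSolution R δ lam c x z) (h' : IsSolution R δ lam c x' z')
    {ε : ℝ} {v : E → ℝ} (hv : IsContractionWeight R ε v)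
    (hR : ∀ j i, 0 ≤ R j i) (hδ : ∀ j i, 0 ≤ δ j i)
    (hlam : ∀ i a b, IntervalIntegrable (lam i) volume a b) (i : E) (d : ℝ) :
    Tendsto (fun t => ∫ s in (t - d)..t, |z i s - z' i s|) atTop (𝓝 0) := by
  have hi : IntegrableOn (fun s => |z i s - z' i s|) (Ioi 0) :=
    (h.integrableOn_Ioi h' hv hR hδ hlam i).1.norm
  have h1 := intervalIntegral_tendsto_integral_Ioi 0 hi tendsto_id
  have h2 := intervalIntegral_tendsto_integral_Ioi 0 hi
    (tendsto_atTop_add_const_right atTop (-d) tendsto_id)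
  have h3 := h1.sub h2
  rw [sub_self] at h3
  refine h3.congr' ?_
  filter_upwards [eventually_ge_atTop 0, eventually_ge_atTop d] with t ht htd
  have hii : ∀ r, 0 ≤ r → IntervalIntegrable (fun s => |z i s - z' i s|) volume 0 r := fun r hr =>
    (intervalIntegrable_iff_integrableOn_Ioc_of_le hr).2 (hi.mono_set Ioc_subset_Ioi_self)
  simp only [id]
  rw [intervalIntegral.integral_interval_sub_left (hii t ht) (hii (t + -d) (by linarith)),
    ← sub_eq_add_neg]

/-- The difference of the queues is the primitive of a function that is integrable on the half-line.
-/
theorem exists_tendsto_sub (h : IsSolution R δ lam c x z) (h' : IsSolution R δ lam c x' z')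
    {ε : ℝ} {v : E → ℝ} (hv : IsContractionWeight R ε v)
    (hR : ∀ j i, 0 ≤ R j i) (hδ : ∀ j i, 0 ≤ δ j i)
    (hlam : ∀ i a b, IntervalIntegrable (lam i) volume a b) (i : E) :
    ∃ l, Tendsto (fun t => x i t - x' i t) atTop (𝓝 l) := by
  have hm0 := maxDelay_nonneg (R := R) hδ
  obtain ⟨hz, hy⟩ := h.integrableOn_Ioi h' hv hR hδ hlam i
  have h1 := (intervalIntegral_tendsto_integral_Ioi 0 (hy.sub hz) tendsto_id).const_add
    (x i 0 - x' i 0)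
  refine ⟨_, h1.congr' ?_⟩
  filter_upwards [eventually_ge_atTop 0] with t ht
  have hz0 : ∀ {x z}, IsSolution R δ lam c x z → IntervalIntegrable (z i) volume 0 t := by
    intro x z h
    refine (h.integrable i t ht).mono_set ?_
    rw [uIcc_of_le ht, uIcc_of_le (by linarith)]
    exact Icc_subset_Icc (by linarith) le_rfl
  have hyi := intervalIntegrable_inflow hR hδ hlam ht (fun j => h.integrable j t ht) i
  have hyi' := intervalIntegrable_inflow hR hδ hlam ht (fun j => h'.integrable j t ht) i
  rw [h.queue i t ht, h'.queue i t ht, add_sub_add_comm,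
    ← intervalIntegral.integral_sub (hyi.sub (hz0 h)) (hyi'.sub (hz0 h'))]
  congr 1
  refine intervalIntegral.integral_congr fun s _ => ?_
  simp only [Pi.sub_apply]
  ring

/-- A solution whose outflows are periodic and on average below the capacities attracts all
solutions. -/
theorem tendsto_sub_zero (h : IsSolution R δ lam c x z) (h' : IsSolution R δ lam c x' z')
    {ε : ℝ} {v : E → ℝ} (hv : IsContractionWeight R ε v)
    (hR : ∀ j i, 0 ≤ R j i) (hδ : ∀ j i, 0 ≤ δ j i)
    (hlam : ∀ i a b, IntervalIntegrable (lam i) volume a b) {T : ℝ} (hT : 0 < T)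
    (hc : ∀ i, Function.Periodic (c i) T) (hci : ∀ i a b, IntervalIntegrable (c i) volume a b)
    (hz' : ∀ i, Function.Periodic (z' i) T) (hzi' : ∀ i a b, IntervalIntegrable (z' i) volume a b)
    (hlt : ∀ i, ∫ s in (0 : ℝ)..T, z' i s < ∫ s in (0 : ℝ)..T, c i s) (i : E) :
    Tendsto (fun t => x i t - x' i t) atTop (𝓝 0) := by
  obtain ⟨l, hl⟩ := h.exists_tendsto_sub h' hv hR hδ hlam i
  have hperiod : ∀ a, ∫ s in a..a + T, z' i s < ∫ s in a..a + T, c i s := fun a => by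
    rw [(hz' i).intervalIntegral_add_eq a 0, (hc i).intervalIntegral_add_eq a 0, zero_add]
    exact hlt i
  rcases lt_trichotomy l 0 with hl0 | rfl | hl0
  -- If `l < 0`, then `x'` is positive from some time on, so `z' = c` over a whole period, against
  -- `hlt`.
  · obtain ⟨t₀, ht₀⟩ := eventually_atTop.1 ((hl.eventually (gt_mem_nhds hl0)).and
      (eventually_ge_atTop (0 : ℝ)))
    refine absurd (hperiod t₀) (not_lt.2 (le_of_eq ?_))
    refine intervalIntegral.integral_congr fun s hs => ?_
    rw [uIcc_of_le (by linarith)] at hs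
    obtain ⟨h1, h2⟩ := ht₀ s hs.1
    have h3 := h.queue_nonneg i s h2
    rw [h'.outflow i s h2, linkOutflow_of_pos (by linarith)]
  · exact hl
  -- If `l > 0`, then `z = c` from some time on, so the integral of `|z - z'|` over each period is
  -- the constant mean gap of `c` and `z'`. It tends to zero as well, against `hlt`.
  · obtain ⟨t₀, ht₀⟩ := eventually_atTop.1 ((hl.eventually (lt_mem_nhds hl0)).and
      (eventually_ge_atTop (0 : ℝ)))
    have h0 := h.tendsto_integral_abs_sub h' hv hR hδ hlam i T
    have hconst : ∀ᶠ t in atTop, (∫ s in (0 : ℝ)..T, c i s) - ∫ s in (0 : ℝ)..T, z' i s =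
        ∫ s in (t - T)..t, |z i s - z' i s| := by
      filter_upwards [eventually_ge_atTop (t₀ + T)] with t ht
      have h1 := (hz' i).intervalIntegral_add_eq (t - T) 0
      have h2 := (hc i).intervalIntegral_add_eq (t - T) 0
      simp only [sub_add_cancel, zero_add] at h1 h2
      rw [← h1, ← h2, ← intervalIntegral.integral_sub (hci i _ _) (hzi' i _ _)]
      refine intervalIntegral.integral_congr fun s hs => ?_
      rw [uIcc_of_le (by linarith)] at hs
      obtain ⟨h3, h4⟩ := ht₀ s (by linarith [hs.1])
      have h5 := h'.queue_nonneg i s h4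
      have h6 : z' i s ≤ c i s := h'.outflow i s h4 ▸ linkOutflow_le
      rw [h.outflow i s h4, linkOutflow_of_pos (by linarith), abs_of_nonneg (by linarith)]
    have := tendsto_nhds_unique h0 (tendsto_const_nhds.congr' hconst)
    linarith [hlt i]

end IsSolution

end Contraction

/-! ## Periodic flows through the network -/

section PeriodicFlows

variable {E : Type*} [Fintype E] {R : Matrix E E ℝ} {δ : E → E → ℝ} {lam c z : E → ℝ → ℝ} {T : ℝ}

/-- The weight is the vector of mean capacities: as the mean external inflows are nonnegative, the
stability margin `ε` becomes the contraction margin. -/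
theorem StabilityCondition.exists_weight (hT : 0 < T) (hR : ∀ j i, 0 ≤ R j i)
    (hlam : ∀ i t, 0 ≤ lam i t) (hc : ∀ i t, 0 ≤ c i t) (h : StabilityCondition T R lam c) :
    (∃ ε v, IsContractionWeight R ε v) ∧
      ∀ i, (∫ s in (0 : ℝ)..T, lam i s) + ∑ j, R j i * ∫ s in (0 : ℝ)..T, c j s <
        ∫ s in (0 : ℝ)..T, c i s := by
  obtain ⟨ε, hε, h⟩ := h
  have havg : ∀ {f : ℝ → ℝ}, (∀ t, 0 ≤ f t) → 0 ≤ average T f := fun hf =>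
    mul_nonneg (by positivity) (intervalIntegral.integral_nonneg hT.le fun t _ => hf t)
  refine ⟨⟨ε, fun i => average T (c i), hε, fun i => ?_, fun i => ?_⟩, fun i => ?_⟩
  · have h1 := Finset.sum_nonneg fun j (_ : j ∈ Finset.univ) =>
      mul_nonneg (hR j i) (havg (hc j))
    linarith [h i, havg (hlam i)]
  · linarith [h i, havg (hlam i)]
  · have h1 : ∀ f : ℝ → ℝ, ∫ s in (0 : ℝ)..T, f s = T * average T f := fun f => by
      rw [average, ← mul_assoc, mul_one_div_cancel hT.ne', one_mul]
    have h2 : ∑ j, R j i * (T * average T (c j)) = T * ∑ j, R j i * average T (c j) := by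
      rw [Finset.mul_sum]
      exact Finset.sum_congr rfl fun j _ => by ring
    simp only [h1, h2]
    rw [← mul_add]
    exact mul_lt_mul_of_pos_left (by linarith [h i]) hT

theorem inflow_periodic (hlam : ∀ i, Function.Periodic (lam i) T)
    (hz : ∀ i, Function.Periodic (z i) T) (i : E) :
    Function.Periodic (inflow R δ lam z i) T := fun t => by
  simp only [inflow, hlam i t, add_sub_right_comm, hz _ _]

theorem inflow_mono (hR : ∀ j i, 0 ≤ R j i) {z' : E → ℝ → ℝ} (h : ∀ i t, z i t ≤ z' i t) (i : E)
    (t : ℝ) : inflow R δ lam z i t ≤ inflow R δ lam z' i t :=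
  add_le_add_right (Finset.sum_le_sum fun j _ => mul_le_mul_of_nonneg_left (h j _) (hR j i)) _

theorem le_inflow (hR : ∀ j i, 0 ≤ R j i) (hz : ∀ i t, 0 ≤ z i t) (i : E) (t : ℝ) :
    lam i t ≤ inflow R δ lam z i t :=
  le_add_of_nonneg_right (Finset.sum_nonneg fun j _ => mul_nonneg (hR j i) (hz j _))

theorem IsStep.inflow (hlam : ∀ i, IsStep (lam i)) (hz : ∀ i, IsStep (z i)) (i : E) :
    IsStep (inflow R δ lam z i) :=
  IsStep.comp₂ (· + ·) (hlam i) (IsStep.sum Finset.univ fun j _ =>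
    IsStep.comp₂ (fun a _ => R j i * a) ((hz j).shift (δ j i)) (IsStep.const 0))

theorem intervalIntegrable_comp_sub {f : ℝ → ℝ} (hf : ∀ a b, IntervalIntegrable f volume a b)
    (d a b : ℝ) : IntervalIntegrable (fun s => f (s - d)) volume a b := by
  have := (hf (a - d) (b - d)).comp_sub_right d
  simpa using this

theorem intervalIntegrable_inflow_of_forall (hlam : ∀ i a b, IntervalIntegrable (lam i) volume a b)
    (hz : ∀ i a b, IntervalIntegrable (z i) volume a b) (i : E) (a b : ℝ) :
    IntervalIntegrable (inflow R δ lam z i) volume a b := by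
  have h := IntervalIntegrable.sum Finset.univ fun j (_ : j ∈ Finset.univ) =>
    (intervalIntegrable_comp_sub (hz j) (δ j i) a b).const_mul (R j i)
  refine ((hlam i a b).add h).congr (fun s _ => ?_)
  simp [inflow]

theorem integral_comp_sub_of_periodic {f : ℝ → ℝ} (hf : Function.Periodic f T) (d : ℝ) :
    ∫ s in (0 : ℝ)..T, f (s - d) = ∫ s in (0 : ℝ)..T, f s := by
  rw [intervalIntegral.integral_comp_sub_right f d]
  have := hf.intervalIntegral_add_eq (0 - d) 0
  rwa [zero_add, show 0 - d + T = T - d by ring] at this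

theorem integral_sum_routed (hz : ∀ i a b, IntervalIntegrable (z i) volume a b)
    (hzp : ∀ i, Function.Periodic (z i) T) (i : E) :
    ∫ s in (0 : ℝ)..T, ∑ j, R j i * z j (s - δ j i) =
      ∑ j, R j i * ∫ s in (0 : ℝ)..T, z j s := by
  rw [intervalIntegral.integral_finsetSum fun j _ =>
    (intervalIntegrable_comp_sub (hz j) (δ j i) 0 T).const_mul (R j i)]
  refine Finset.sum_congr rfl fun j _ => ?_
  rw [intervalIntegral.integral_const_mul, integral_comp_sub_of_periodic (hzp j)]

theorem intervalIntegrable_sum_routed (hz : ∀ i a b, IntervalIntegrable (z i) volume a b)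
    (i : E) (a b : ℝ) :
    IntervalIntegrable (fun s => ∑ j, R j i * z j (s - δ j i)) volume a b := by
  refine (IntervalIntegrable.sum Finset.univ fun j (_ : j ∈ Finset.univ) =>
    (intervalIntegrable_comp_sub (hz j) (δ j i) a b).const_mul (R j i)).congr (fun s _ => ?_)
  simp

theorem integral_inflow (hlam : ∀ i a b, IntervalIntegrable (lam i) volume a b)
    (hz : ∀ i a b, IntervalIntegrable (z i) volume a b)
    (hzp : ∀ i, Function.Periodic (z i) T) (i : E) :
    ∫ s in (0 : ℝ)..T, inflow R δ lam z i s =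
      (∫ s in (0 : ℝ)..T, lam i s) + ∑ j, R j i * ∫ s in (0 : ℝ)..T, z j s := by
  rw [← integral_sum_routed (δ := δ) hz hzp i, ← intervalIntegral.integral_add (hlam i 0 T)
    (intervalIntegrable_sum_routed hz i 0 T)]
  rfl

/-- Outflows bounded by capacities route at most the mean inflow that the stability condition
allows; this is what keeps every iterate, and the limit, within reach of the single-link theory. -/
theorem integral_inflow_lt (hT : 0 < T) (hR : ∀ j i, 0 ≤ R j i)
    (hlam : ∀ i a b, IntervalIntegrable (lam i) volume a b)
    (hc : ∀ i a b, IntervalIntegrable (c i) volume a b)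
    (hstab : ∀ i, (∫ s in (0 : ℝ)..T, lam i s) + ∑ j, R j i * ∫ s in (0 : ℝ)..T, c j s <
        ∫ s in (0 : ℝ)..T, c i s)
    (hz : ∀ i a b, IntervalIntegrable (z i) volume a b)
    (hzp : ∀ i, Function.Periodic (z i) T) (hzc : ∀ i t, z i t ≤ c i t) (i : E) :
    ∫ s in (0 : ℝ)..T, inflow R δ lam z i s < ∫ s in (0 : ℝ)..T, c i s := by
  rw [integral_inflow hlam hz hzp]
  refine lt_of_le_of_lt ?_ (hstab i)
  gcongr with j _
  · exact hR j i
  · exact intervalIntegral.integral_mono_on hT.le (hz j 0 T) (hc j 0 T) fun t _ => hzc j t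

end PeriodicFlows

/-! ## The iterates of the network algorithm -/

section Iterates

/-- The outflows when every link is loaded with its periodic queue for the inflows `y`. -/
noncomputable def periodicOutflow {E : Type*} (T : ℝ) (c y : E → ℝ → ℝ) (i : E) (t : ℝ) : ℝ :=
  linkOutflow (periodicQueue T (fun r => y i r - c i r) t) (y i t) (c i t)

theorem periodicOutflow_le {E : Type*} {T : ℝ} {c : E → ℝ → ℝ} (y : E → ℝ → ℝ) (i : E) (t : ℝ) :
    periodicOutflow T c y i t ≤ c i t :=
  linkOutflow_le

variable {E : Type*} [Fintype E]

/-- The inflows in the iterations of the network algorithm. -/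
noncomputable def inflowIterate (T : ℝ) (R : Matrix E E ℝ) (δ : E → E → ℝ)
    (lam c : E → ℝ → ℝ) : ℕ → E → ℝ → ℝ
  | 0 => lam
  | k + 1 => inflow R δ lam (periodicOutflow T c (inflowIterate T R δ lam c k))

/-- The queue lengths in the iterations of the network algorithm. -/
noncomputable def queueIterate (T : ℝ) (R : Matrix E E ℝ) (δ : E → E → ℝ)
    (lam c : E → ℝ → ℝ) (k : ℕ) (i : E) : ℝ → ℝ :=
  periodicQueue T fun r => inflowIterate T R δ lam c k i r - c i r

/-- The outflows in the iterations of the network algorithm. -/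
noncomputable def outflowIterate (T : ℝ) (R : Matrix E E ℝ) (δ : E → E → ℝ)
    (lam c : E → ℝ → ℝ) (k : ℕ) : E → ℝ → ℝ :=
  periodicOutflow T c (inflowIterate T R δ lam c k)

/-- Standing assumptions on the network. -/
structure IsStableNetwork (T : ℝ) (R : Matrix E E ℝ) (lam c : E → ℝ → ℝ) : Prop where
  period_pos : 0 < T
  routing_nonneg : ∀ j i, 0 ≤ R j i
  lam_nonneg : ∀ i t, 0 ≤ lam i t
  cap_nonneg : ∀ i t, 0 ≤ c i t
  lam_periodic : ∀ i, Function.Periodic (lam i) T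
  cap_periodic : ∀ i, Function.Periodic (c i) T
  lam_step : ∀ i, IsStep (lam i)
  cap_step : ∀ i, IsStep (c i)
  stable : ∀ i, (∫ s in (0 : ℝ)..T, lam i s) + ∑ j, R j i * ∫ s in (0 : ℝ)..T, c j s <
    ∫ s in (0 : ℝ)..T, c i s

/-- Inflows to which the single-link algorithm applies. -/
structure IsAdmissible (T : ℝ) (c y : ℝ → ℝ) : Prop where
  step : IsStep y
  periodic : Function.Periodic y T
  nonneg : ∀ t, 0 ≤ y t
  integral_lt : ∫ s in (0 : ℝ)..T, y s < ∫ s in (0 : ℝ)..T, c s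

variable {T : ℝ} {R : Matrix E E ℝ} {δ : E → E → ℝ} {lam c : E → ℝ → ℝ}

theorem IsAdmissible.integral_sub_nonpos {c y : ℝ → ℝ} (hy : IsAdmissible T c y) (hc : IsStep c) :
    ∫ s in (0 : ℝ)..T, (y s - c s) ≤ 0 := by
  rw [intervalIntegral.integral_sub (hy.step.intervalIntegrable 0 T) (hc.intervalIntegrable 0 T)]
  linarith [hy.integral_lt]

namespace IsStableNetwork

theorem intervalIntegrable_lam (N : IsStableNetwork T R lam c) (i : E) (a b : ℝ) :
    IntervalIntegrable (lam i) volume a b := (N.lam_step i).intervalIntegrable a b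

theorem intervalIntegrable_cap (N : IsStableNetwork T R lam c) (i : E) (a b : ℝ) :
    IntervalIntegrable (c i) volume a b := (N.cap_step i).intervalIntegrable a b

theorem isStep_periodicOutflow (N : IsStableNetwork T R lam c) {y : E → ℝ → ℝ}
    (hy : ∀ i, IsAdmissible T (c i) (y i)) (i : E) : IsStep (periodicOutflow T c y i) :=
  IsStep.outflow N.period_pos (hy i).step (N.cap_step i) (hy i).periodic (N.cap_periodic i)
    ((hy i).integral_sub_nonpos (N.cap_step i))

theorem periodic_periodicOutflow (N : IsStableNetwork T R lam c) {y : E → ℝ → ℝ}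
    (hy : ∀ i, Function.Periodic (y i) T) (i : E) :
    Function.Periodic (periodicOutflow T c y i) T := fun t => by
  have hper : Function.Periodic (fun r => y i r - c i r) T := fun r => by
    simp only [hy i r, N.cap_periodic i r]
  simp only [periodicOutflow, periodicQueue_periodic hper t, hy i t, N.cap_periodic i t]

theorem isAdmissible_inflow (N : IsStableNetwork T R lam c) {y : E → ℝ → ℝ}
    (hy : ∀ i, IsAdmissible T (c i) (y i)) (i : E) :
    IsAdmissible T (c i) (inflow R δ lam (periodicOutflow T c y) i) where
  step := IsStep.inflow N.lam_step (N.isStep_periodicOutflow hy) i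
  periodic := inflow_periodic N.lam_periodic
    (N.periodic_periodicOutflow fun i => (hy i).periodic) i
  nonneg t := (N.lam_nonneg i t).trans (le_inflow N.routing_nonneg
    (fun i t => linkOutflow_nonneg ((hy i).nonneg t) (N.cap_nonneg i t)) i t)
  integral_lt := integral_inflow_lt N.period_pos N.routing_nonneg N.intervalIntegrable_lam
    N.intervalIntegrable_cap N.stable (fun i => (N.isStep_periodicOutflow hy i).intervalIntegrable)
    (N.periodic_periodicOutflow fun i => (hy i).periodic) (periodicOutflow_le y) i

theorem isAdmissible (N : IsStableNetwork T R lam c) (k : ℕ) :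
    ∀ i, IsAdmissible T (c i) (inflowIterate T R δ lam c k i) := by
  induction k with
  | zero =>
    intro i
    refine ⟨N.lam_step i, N.lam_periodic i, N.lam_nonneg i, ?_⟩
    have : 0 ≤ ∑ j, R j i * ∫ s in (0 : ℝ)..T, c j s :=
      Finset.sum_nonneg fun j _ => mul_nonneg (N.routing_nonneg j i)
        (intervalIntegral.integral_nonneg N.period_pos.le fun t _ => N.cap_nonneg j t)
    have h := N.stable i
    simp only [inflowIterate]
    linarith
  | succ k ih => exact fun i => N.isAdmissible_inflow ih i

theorem isSingleLinkOutput_iff (N : IsStableNetwork T R lam c) (k : ℕ) (i : E) {x z : ℝ → ℝ} :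
    IsSingleLinkOutput T (inflowIterate T R δ lam c k i) (c i) x z ↔
      x = queueIterate T R δ lam c k i ∧ z = outflowIterate T R δ lam c k i := by
  have hy := N.isAdmissible (δ := δ) k i
  exact TrafficNetwork.isSingleLinkOutput_iff N.period_pos hy.step (N.cap_step i) hy.periodic
    (N.cap_periodic i) (hy.integral_sub_nonpos (N.cap_step i))

/-- The network algorithm has exactly one sequence of iterates. -/
theorem isAlgorithmRun_iff (N : IsStableNetwork T R lam c) {x z : ℕ → E → ℝ → ℝ} :
    IsAlgorithmRun T R δ lam c x z ↔
      x = queueIterate T R δ lam c ∧ z = outflowIterate T R δ lam c := by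
  constructor
  · intro h
    have key : ∀ k, x k = queueIterate T R δ lam c k ∧ z k = outflowIterate T R δ lam c k := by
      intro k
      induction k with
      | zero =>
        have h0 := fun i => (N.isSingleLinkOutput_iff (δ := δ) 0 i).1 (h.first i)
        exact ⟨funext fun i => (h0 i).1, funext fun i => (h0 i).2⟩
      | succ k ih =>
        have h0 := fun i => (N.isSingleLinkOutput_iff (δ := δ) (k + 1) i (x := x (k + 1) i)
          (z := z (k + 1) i)).1 (by
            have := h.next k i
            rw [ih.2] at this
            exact this)
        exact ⟨funext fun i => (h0 i).1, funext fun i => (h0 i).2⟩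
    exact ⟨funext fun k => (key k).1, funext fun k => (key k).2⟩
  · rintro ⟨rfl, rfl⟩
    exact ⟨fun i => (N.isSingleLinkOutput_iff 0 i).2 ⟨rfl, rfl⟩,
      fun k i => (N.isSingleLinkOutput_iff (k + 1) i).2 ⟨rfl, rfl⟩⟩

theorem intervalIntegrable_netInflow (N : IsStableNetwork T R lam c) (k : ℕ) (i : E) (a b : ℝ) :
    IntervalIntegrable (fun r => inflowIterate T R δ lam c k i r - c i r) volume a b :=
  ((N.isAdmissible k i).step.intervalIntegrable a b).sub (N.intervalIntegrable_cap i a b)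

theorem outflowIterate_nonneg (N : IsStableNetwork T R lam c) (k : ℕ) (i : E) (t : ℝ) :
    0 ≤ outflowIterate T R δ lam c k i t :=
  linkOutflow_nonneg ((N.isAdmissible k i).nonneg t) (N.cap_nonneg i t)

theorem outflowIterate_le (k : ℕ) (i : E) (t : ℝ) : outflowIterate T R δ lam c k i t ≤ c i t :=
  linkOutflow_le

theorem periodic_outflowIterate (N : IsStableNetwork T R lam c) (k : ℕ) (i : E) :
    Function.Periodic (outflowIterate T R δ lam c k i) T :=
  N.periodic_periodicOutflow (fun i => (N.isAdmissible k i).periodic) i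

theorem intervalIntegrable_outflowIterate (N : IsStableNetwork T R lam c) (k : ℕ) (i : E)
    (a b : ℝ) : IntervalIntegrable (outflowIterate T R δ lam c k i) volume a b :=
  (N.isStep_periodicOutflow (N.isAdmissible k) i).intervalIntegrable a b

theorem queueIterate_nonneg (N : IsStableNetwork T R lam c) (k : ℕ) (i : E) (t : ℝ) :
    0 ≤ queueIterate T R δ lam c k i t :=
  periodicQueue_nonneg N.period_pos (N.intervalIntegrable_netInflow k i) t

/-- A queue is built up within one period, so it is at most the inflow of a period, which is less
than the capacity of a period. The sum over all links makes the bound independent of `i`. -/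
theorem queueIterate_le (N : IsStableNetwork T R lam c) (k : ℕ) (i : E) (t : ℝ) :
    queueIterate T R δ lam c k i t ≤ ∑ j, ∫ s in (0 : ℝ)..T, c j s := by
  have hy := N.isAdmissible (δ := δ) k i
  obtain ⟨s, hs, h⟩ := exists_periodicQueue_eq N.period_pos
    (N.intervalIntegrable_netInflow (δ := δ) k i) t
  rw [queueIterate, h]
  have h1 : ∫ r in s..t, (inflowIterate T R δ lam c k i r - c i r) ≤
      ∫ r in s..t, inflowIterate T R δ lam c k i r :=
    intervalIntegral.integral_mono_on hs.2 (N.intervalIntegrable_netInflow k i s t)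
      (hy.step.intervalIntegrable s t) fun r _ => by linarith [N.cap_nonneg i r]
  have h2 : ∫ r in s..t, inflowIterate T R δ lam c k i r ≤
      ∫ r in (t - T)..t, inflowIterate T R δ lam c k i r :=
    intervalIntegral.integral_mono_interval hs.1 hs.2 le_rfl (ae_of_all _ hy.nonneg)
      (hy.step.intervalIntegrable _ _)
  have h3 := hy.periodic.intervalIntegral_add_eq (t - T) 0
  simp only [sub_add_cancel, zero_add] at h3
  have h4 : ∫ s in (0 : ℝ)..T, c i s ≤ ∑ j, ∫ s in (0 : ℝ)..T, c j s :=
    Finset.single_le_sum (f := fun j => ∫ s in (0 : ℝ)..T, c j s) (fun j _ =>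
      intervalIntegral.integral_nonneg N.period_pos.le fun t _ => N.cap_nonneg j t)
      (Finset.mem_univ i)
  linarith [hy.integral_lt]

theorem inflowIterate_le_succ (N : IsStableNetwork T R lam c) (k : ℕ) :
    ∀ i t, inflowIterate T R δ lam c k i t ≤ inflowIterate T R δ lam c (k + 1) i t := by
  induction k with
  | zero => exact le_inflow N.routing_nonneg (N.outflowIterate_nonneg (δ := δ) 0)
  | succ k ih =>
    exact inflow_mono N.routing_nonneg fun i t => linkOutflow_mono
      (periodicQueue_mono N.period_pos (N.intervalIntegrable_netInflow k i)
        (N.intervalIntegrable_netInflow (k + 1) i) (fun t => sub_le_sub_right (ih i t) _) t)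
      (ih i t)

theorem queueIterate_le_succ (N : IsStableNetwork T R lam c) (k : ℕ) (i : E) (t : ℝ) :
    queueIterate T R δ lam c k i t ≤ queueIterate T R δ lam c (k + 1) i t :=
  periodicQueue_mono N.period_pos (N.intervalIntegrable_netInflow k i)
    (N.intervalIntegrable_netInflow (k + 1) i)
    (fun t => sub_le_sub_right (N.inflowIterate_le_succ k i t) _) t

theorem outflowIterate_le_succ (N : IsStableNetwork T R lam c) (k : ℕ) (i : E) (t : ℝ) :
    outflowIterate T R δ lam c k i t ≤ outflowIterate T R δ lam c (k + 1) i t :=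
  linkOutflow_mono (N.queueIterate_le_succ k i t) (N.inflowIterate_le_succ k i t)

end IsStableNetwork

end Iterates

/-! ## The limit of the iterates -/

section Limit

variable {E : Type*} [Fintype E] {T : ℝ} {R : Matrix E E ℝ} {δ : E → E → ℝ} {lam c : E → ℝ → ℝ}

/-- The limit of the outflows. -/
noncomputable def outflowLimit (T : ℝ) (R : Matrix E E ℝ) (δ : E → E → ℝ) (lam c : E → ℝ → ℝ)
    (i : E) (t : ℝ) : ℝ :=
  ⨆ k, outflowIterate T R δ lam c k i t

/-- The limit of the queue lengths. -/
noncomputable def queueLimit (T : ℝ) (R : Matrix E E ℝ) (δ : E → E → ℝ) (lam c : E → ℝ → ℝ)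
    (i : E) : ℝ → ℝ :=
  periodicQueue T fun r => inflow R δ lam (outflowLimit T R δ lam c) i r - c i r

namespace IsStableNetwork

theorem bddAbove_outflowIterate (i : E) (t : ℝ) :
    BddAbove (range fun k => outflowIterate T R δ lam c k i t) :=
  ⟨c i t, by rintro _ ⟨k, rfl⟩; exact outflowIterate_le k i t⟩

theorem tendsto_outflowIterate (N : IsStableNetwork T R lam c) (i : E) (t : ℝ) :
    Tendsto (fun k => outflowIterate T R δ lam c k i t) atTop
      (𝓝 (outflowLimit T R δ lam c i t)) :=
  tendsto_atTop_ciSup (monotone_nat_of_le_succ fun k => N.outflowIterate_le_succ k i t)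
    (bddAbove_outflowIterate i t)

theorem outflowIterate_le_limit (k : ℕ) (i : E) (t : ℝ) :
    outflowIterate T R δ lam c k i t ≤ outflowLimit T R δ lam c i t :=
  le_ciSup (bddAbove_outflowIterate i t) k

theorem outflowLimit_le (i : E) (t : ℝ) : outflowLimit T R δ lam c i t ≤ c i t :=
  ciSup_le fun k => outflowIterate_le k i t

theorem outflowLimit_nonneg (N : IsStableNetwork T R lam c) (i : E) (t : ℝ) :
    0 ≤ outflowLimit T R δ lam c i t :=
  (N.outflowIterate_nonneg 0 i t).trans (outflowIterate_le_limit 0 i t)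

theorem periodic_outflowLimit (N : IsStableNetwork T R lam c) (i : E) :
    Function.Periodic (outflowLimit T R δ lam c i) T := fun t => by
  simp only [outflowLimit, N.periodic_outflowIterate _ i t]

/-- A pointwise limit of step functions need not be a step function, so integrability comes from
measurability of the limit and the bound by the capacity. -/
theorem intervalIntegrable_outflowLimit (N : IsStableNetwork T R lam c) (i : E) (a b : ℝ) :
    IntervalIntegrable (outflowLimit T R δ lam c i) volume a b := by
  refine (N.intervalIntegrable_cap i a b).mono_fun' ?_ (ae_of_all _ fun t => ?_)
  · exact aestronglyMeasurable_of_tendsto_ae atTop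
      (fun k => (N.intervalIntegrable_outflowIterate (δ := δ) k i a b).def'.aestronglyMeasurable)
      (ae_of_all _ fun t => N.tendsto_outflowIterate i t)
  · exact (Real.norm_of_nonneg (N.outflowLimit_nonneg i t)).trans_le (outflowLimit_le i t)

theorem intervalIntegrable_inflowLimit (N : IsStableNetwork T R lam c) (i : E) (a b : ℝ) :
    IntervalIntegrable (inflow R δ lam (outflowLimit T R δ lam c) i) volume a b :=
  intervalIntegrable_inflow_of_forall N.intervalIntegrable_lam N.intervalIntegrable_outflowLimit
    i a b

theorem intervalIntegrable_netInflowLimit (N : IsStableNetwork T R lam c) (i : E) (a b : ℝ) :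
    IntervalIntegrable (fun r => inflow R δ lam (outflowLimit T R δ lam c) i r - c i r)
      volume a b :=
  (N.intervalIntegrable_inflowLimit i a b).sub (N.intervalIntegrable_cap i a b)

theorem periodic_inflowLimit (N : IsStableNetwork T R lam c) (i : E) :
    Function.Periodic (inflow R δ lam (outflowLimit T R δ lam c) i) T :=
  inflow_periodic N.lam_periodic N.periodic_outflowLimit i

theorem periodic_queueLimit (N : IsStableNetwork T R lam c) (i : E) :
    Function.Periodic (queueLimit T R δ lam c i) T :=
  periodicQueue_periodic fun t => by
    simp only [N.periodic_inflowLimit i t, N.cap_periodic i t]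

theorem queueLimit_nonneg (N : IsStableNetwork T R lam c) (i : E) (t : ℝ) :
    0 ≤ queueLimit T R δ lam c i t :=
  periodicQueue_nonneg N.period_pos (N.intervalIntegrable_netInflowLimit i) t

theorem tendsto_integral_outflowIterate_sub (N : IsStableNetwork T R lam c) (i : E) :
    Tendsto (fun k => ∫ t in (0 : ℝ)..T,
      |outflowIterate T R δ lam c k i t - outflowLimit T R δ lam c i t|) atTop (𝓝 0) := by
  have h := intervalIntegral.tendsto_integral_filter_of_dominated_convergence
    (μ := volume) (a := 0) (b := T) (l := atTop) (f := fun _ => (0 : ℝ))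
    (F := fun k t => |outflowIterate T R δ lam c k i t - outflowLimit T R δ lam c i t|) (c i)
    (Eventually.of_forall fun k => ((N.intervalIntegrable_outflowIterate k i 0 T).sub
      (N.intervalIntegrable_outflowLimit i 0 T)).abs.def'.aestronglyMeasurable)
    (Eventually.of_forall fun k => ae_of_all _ fun t _ => ?_)
    (N.intervalIntegrable_cap i 0 T) (ae_of_all _ fun t _ => ?_)
  · simpa using h
  · rw [Real.norm_eq_abs, abs_abs, abs_le]
    have h1 := outflowIterate_le_limit (T := T) (R := R) (δ := δ) (lam := lam) (c := c) k i t
    have h2 := outflowLimit_le (T := T) (R := R) (δ := δ) (lam := lam) (c := c) i t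
    have h3 := N.outflowIterate_nonneg (δ := δ) k i t
    constructor <;> linarith [N.cap_nonneg i t]
  · simpa using ((N.tendsto_outflowIterate (δ := δ) i t).sub_const
      (outflowLimit T R δ lam c i t)).abs

theorem tendsto_integral_inflowIterate_sub (N : IsStableNetwork T R lam c) (i : E) :
    Tendsto (fun k => ∫ t in (0 : ℝ)..T, |inflowIterate T R δ lam c (k + 1) i t -
      inflow R δ lam (outflowLimit T R δ lam c) i t|) atTop (𝓝 0) := by
  have hz : ∀ k j a b, IntervalIntegrable (fun t => |outflowIterate T R δ lam c k j t -
      outflowLimit T R δ lam c j t|) volume a b := fun k j a b =>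
    ((N.intervalIntegrable_outflowIterate k j a b).sub
      (N.intervalIntegrable_outflowLimit j a b)).abs
  have hlim : Tendsto (fun k => ∑ j, R j i * ∫ t in (0 : ℝ)..T,
      |outflowIterate T R δ lam c k j t - outflowLimit T R δ lam c j t|) atTop (𝓝 0) := by
    have := tendsto_finsetSum Finset.univ fun j (_ : j ∈ Finset.univ) =>
      (N.tendsto_integral_outflowIterate_sub (δ := δ) j).const_mul (R j i)
    simpa using this
  refine squeeze_zero (fun k => intervalIntegral.integral_nonneg N.period_pos.le
    fun _ _ => abs_nonneg _) (fun k => ?_) hlim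
  rw [← integral_sum_routed (δ := δ) (hz k) (fun j t => by
    simp only [N.periodic_outflowIterate k j t, N.periodic_outflowLimit j t]) i]
  exact intervalIntegral.integral_mono_on N.period_pos.le
    (((N.isAdmissible (k + 1) i).step.intervalIntegrable 0 T).sub
      (N.intervalIntegrable_inflowLimit i 0 T)).abs
    (intervalIntegrable_sum_routed (hz k) i 0 T)
    fun t _ => abs_inflow_sub_le N.routing_nonneg i t

theorem tendsto_inflowIterate (N : IsStableNetwork T R lam c) (i : E) (t : ℝ) :
    Tendsto (fun k => inflowIterate T R δ lam c (k + 1) i t) atTop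
      (𝓝 (inflow R δ lam (outflowLimit T R δ lam c) i t)) :=
  (tendsto_finsetSum Finset.univ fun j _ =>
    (N.tendsto_outflowIterate (δ := δ) j (t - δ j i)).const_mul (R j i)).const_add (lam i t)

theorem inflowIterate_le_limit (N : IsStableNetwork T R lam c) (k : ℕ) (i : E) (t : ℝ) :
    inflowIterate T R δ lam c k i t ≤ inflow R δ lam (outflowLimit T R δ lam c) i t := by
  cases k with
  | zero => exact le_inflow N.routing_nonneg N.outflowLimit_nonneg i t
  | succ k => exact inflow_mono N.routing_nonneg (outflowIterate_le_limit k) i t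

theorem queueIterate_le_limit (N : IsStableNetwork T R lam c) (k : ℕ) (i : E) (t : ℝ) :
    queueIterate T R δ lam c k i t ≤ queueLimit T R δ lam c i t :=
  periodicQueue_mono N.period_pos (N.intervalIntegrable_netInflow k i)
    (N.intervalIntegrable_netInflowLimit i)
    (fun t => sub_le_sub_right (N.inflowIterate_le_limit k i t) _) t

theorem tendstoUniformly_queueIterate (N : IsStableNetwork T R lam c) (i : E) :
    TendstoUniformly (fun k => queueIterate T R δ lam c k i) (queueLimit T R δ lam c i)
      atTop := by
  rw [Metric.tendstoUniformly_iff]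
  intro ε hε
  -- Shift the index: the inflow with index `k + 1` is the one built from the outflows with index
  -- `k`.
  rw [← map_add_atTop_eq_nat 1, eventually_map]
  filter_upwards [(N.tendsto_integral_inflowIterate_sub (δ := δ) i).eventually (gt_mem_nhds hε)]
    with k hk t
  rw [dist_comm, Real.dist_eq]
  refine lt_of_le_of_lt ?_ hk
  have h := abs_periodicQueue_sub_le N.period_pos (N.intervalIntegrable_netInflow (δ := δ) (k + 1) i)
    (N.intervalIntegrable_netInflowLimit (δ := δ) i)
    (fun t => by simp only [(N.isAdmissible (k + 1) i).periodic t, N.cap_periodic i t])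
    (fun t => by simp only [N.periodic_inflowLimit i t, N.cap_periodic i t]) t
  simp only [sub_sub_sub_cancel_right] at h
  exact h

theorem tendsto_queueIterate (N : IsStableNetwork T R lam c) (i : E) (t : ℝ) :
    Tendsto (fun k => queueIterate T R δ lam c k i t) atTop (𝓝 (queueLimit T R δ lam c i t)) :=
  (N.tendstoUniformly_queueIterate i).tendsto_at t

/-- The link outflow is discontinuous at an empty queue, but the queues increase to their limit. If
the limit is zero, all iterates are zero and `min` passes to the limit; if it is positive, the
iterates are eventually positive and discharge at capacity. -/
theorem outflowLimit_eq (N : IsStableNetwork T R lam c) (i : E) (t : ℝ) :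
    outflowLimit T R δ lam c i t = linkOutflow (queueLimit T R δ lam c i t)
      (inflow R δ lam (outflowLimit T R δ lam c) i t) (c i t) := by
  have hz := N.tendsto_outflowIterate (δ := δ) i t
  rcases (N.queueLimit_nonneg (δ := δ) i t).eq_or_lt with h | h
  · rw [linkOutflow_of_nonpos h.ge]
    refine tendsto_nhds_unique (hz.comp (tendsto_add_atTop_nat 1)) ?_
    refine (tendsto_const_nhds.min (N.tendsto_inflowIterate i t)).congr fun k => ?_
    have hx : queueIterate T R δ lam c (k + 1) i t ≤ 0 :=
      (N.queueIterate_le_limit (k + 1) i t).trans h.ge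
    exact (linkOutflow_of_nonpos hx).symm
  · rw [linkOutflow_of_pos h]
    refine tendsto_nhds_unique hz (tendsto_const_nhds.congr' ?_)
    filter_upwards [(N.tendsto_queueIterate (δ := δ) i t).eventually (lt_mem_nhds h)] with k hk
    exact (linkOutflow_of_pos hk).symm

/-- The queue equation was derived for step functions only, so it is carried over from the iterates
by dominated convergence. -/
theorem queueLimit_eq_add_integral (N : IsStableNetwork T R lam c) (i : E) {t : ℝ} (ht : 0 ≤ t) :
    queueLimit T R δ lam c i t = queueLimit T R δ lam c i 0 +
      ∫ s in (0 : ℝ)..t, (inflow R δ lam (outflowLimit T R δ lam c) i s -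
        outflowLimit T R δ lam c i s) := by
  have hx := (N.tendsto_queueIterate (δ := δ) i t).comp (tendsto_add_atTop_nat 1)
  have hx0 := (N.tendsto_queueIterate (δ := δ) i 0).comp (tendsto_add_atTop_nat 1)
  have hint := intervalIntegral.tendsto_integral_filter_of_dominated_convergence
    (μ := volume) (a := 0) (b := t) (l := atTop)
    (f := fun s => inflow R δ lam (outflowLimit T R δ lam c) i s - outflowLimit T R δ lam c i s)
    (F := fun k s => inflowIterate T R δ lam c (k + 1) i s -
      outflowIterate T R δ lam c (k + 1) i s)
    (fun s => inflow R δ lam (outflowLimit T R δ lam c) i s + c i s)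
    (Eventually.of_forall fun k => (((N.isAdmissible (k + 1) i).step.intervalIntegrable 0 t).sub
      (N.intervalIntegrable_outflowIterate (k + 1) i 0 t)).def'.aestronglyMeasurable)
    (Eventually.of_forall fun k => ae_of_all _ fun s _ => ?_)
    ((N.intervalIntegrable_inflowLimit i 0 t).add (N.intervalIntegrable_cap i 0 t))
    (ae_of_all _ fun s _ => (N.tendsto_inflowIterate i s).sub
      ((N.tendsto_outflowIterate i s).comp (tendsto_add_atTop_nat 1)))
  · refine tendsto_nhds_unique hx ((hx0.add hint).congr fun k => ?_)
    have hy := N.isAdmissible (δ := δ) (k + 1) i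
    exact (periodicQueue_eq_add_integral N.period_pos hy.step (N.cap_step i) hy.periodic
      (N.cap_periodic i) (hy.integral_sub_nonpos (N.cap_step i)) ht).symm
  · rw [Real.norm_eq_abs, abs_le]
    have h1 := N.inflowIterate_le_limit (δ := δ) (k + 1) i s
    have h2 := (N.isAdmissible (δ := δ) (k + 1) i).nonneg s
    have h3 := N.outflowIterate_nonneg (δ := δ) (k + 1) i s
    have h4 := outflowIterate_le (T := T) (R := R) (δ := δ) (lam := lam) (c := c) (k + 1) i s
    constructor <;> linarith [N.cap_nonneg i s]

theorem isSolution_limit (N : IsStableNetwork T R lam c) :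
    IsSolution R δ lam c (queueLimit T R δ lam c) (outflowLimit T R δ lam c) where
  queue_nonneg i t _ := N.queueLimit_nonneg i t
  integrable i t _ := N.intervalIntegrable_outflowLimit i _ t
  outflow i t _ := N.outflowLimit_eq i t
  queue i _ ht := N.queueLimit_eq_add_integral i ht

/-- Since the queue is periodic, a period's outflow equals its inflow, which is below capacity. -/
theorem integral_outflowLimit_lt (N : IsStableNetwork T R lam c) (i : E) :
    ∫ s in (0 : ℝ)..T, outflowLimit T R δ lam c i s < ∫ s in (0 : ℝ)..T, c i s := by
  have h1 := N.queueLimit_eq_add_integral (δ := δ) i N.period_pos.le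
  have h2 := N.periodic_queueLimit (δ := δ) i 0
  rw [zero_add] at h2
  rw [h2, intervalIntegral.integral_sub (N.intervalIntegrable_inflowLimit i 0 T)
    (N.intervalIntegrable_outflowLimit i 0 T)] at h1
  have h3 := integral_inflow_lt (δ := δ) N.period_pos N.routing_nonneg N.intervalIntegrable_lam
    N.intervalIntegrable_cap N.stable (N.intervalIntegrable_outflowLimit (δ := δ))
    N.periodic_outflowLimit outflowLimit_le i
  linarith

theorem isPeriodicOrbit_limit (N : IsStableNetwork T R lam c) {ε : ℝ} {v η : E → ℝ}
    (hv : IsContractionWeight R ε v) (hη : ∀ i, 0 < η i) :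
    IsPeriodicOrbit T R δ lam c η (queueLimit T R δ lam c) (outflowLimit T R δ lam c) where
  trajectory := (isTrajectory_iff hv N.routing_nonneg hη).2
    ⟨N.isSolution_limit, fun i t _ _ => N.outflowLimit_nonneg i t⟩
  queue_periodic := N.periodic_queueLimit
  outflow_periodic := N.periodic_outflowLimit

theorem isGloballyAttractive_limit (N : IsStableNetwork T R lam c) {ε : ℝ} {v η : E → ℝ}
    (hv : IsContractionWeight R ε v) (hδ : ∀ j i, 0 ≤ δ j i) (hη : ∀ i, 0 < η i) :
    IsGloballyAttractive R δ lam c η (queueLimit T R δ lam c) (outflowLimit T R δ lam c) := by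
  intro x z h
  have hs := ((isTrajectory_iff hv N.routing_nonneg hη).1 h).1
  refine ⟨hs.tendsto_sub_zero N.isSolution_limit hv N.routing_nonneg hδ N.intervalIntegrable_lam
    N.period_pos N.cap_periodic N.intervalIntegrable_cap N.periodic_outflowLimit
    N.intervalIntegrable_outflowLimit N.integral_outflowLimit_lt, ?_⟩
  have := tendsto_finsetSum Finset.univ fun i (_ : i ∈ Finset.univ) =>
    tendsto_finsetSum Finset.univ fun j (_ : j ∈ Finset.univ) =>
      (hs.tendsto_integral_abs_sub (N.isSolution_limit (δ := δ)) hv N.routing_nonneg hδ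
        N.intervalIntegrable_lam j (δ j i)).const_mul (R j i)
  simpa [historyDist] using this

end IsStableNetwork

end Limit

/-! ## Uniqueness of the periodic orbit -/

section Uniqueness

theorem PiecewiseConstantOn.exists_le {T : ℝ} (hT : 0 < T) {f : ℝ → ℝ}
    (hf : PiecewiseConstantOn T f) (hp : Function.Periodic f T) : ∃ C, ∀ t, f t ≤ C := by
  obtain ⟨n, t, -, h0, hl, hc⟩ := hf
  refine ⟨∑ k : Fin n, |f (t k.castSucc)|, fun s => ?_⟩
  obtain ⟨r, hr, hsr⟩ := hp.exists_mem_Ico₀ hT s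
  obtain ⟨k, hk⟩ := exists_mem_Ico_of_partition (t := t) (s := r) (h0 ▸ hr.1) (hl ▸ hr.2)
  rw [hsr, hc k r hk]
  exact (le_abs_self _).trans (Finset.single_le_sum (f := fun k : Fin n => |f (t k.castSucc)|)
    (fun _ _ => abs_nonneg _) (Finset.mem_univ k))

theorem eq_zero_of_periodic_of_tendsto {T : ℝ} (hT : 0 < T) {f : ℝ → ℝ}
    (hf : Function.Periodic f T) (h : Tendsto f atTop (𝓝 0)) (t : ℝ) : f t = 0 := by
  have h1 : Tendsto (fun n : ℕ => t + n * T) atTop atTop :=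
    tendsto_atTop_add_const_left _ _ (tendsto_natCast_atTop_atTop.atTop_mul_const hT)
  refine tendsto_nhds_unique (tendsto_const_nhds.congr fun n => ?_) (h.comp h1)
  exact (hf.nat_mul n t).symm

variable {E : Type*} [Fintype E] {T : ℝ} {R : Matrix E E ℝ} {δ : E → E → ℝ} {lam c : E → ℝ → ℝ}
  {x z : E → ℝ → ℝ}

/-- There are finitely many pairs of links. The bound `d` is the step length for an induction
forward in time. -/
theorem exists_delay_lower_bound (δ : E → E → ℝ) : ∃ d > 0, ∀ j i, 0 < δ j i → d ≤ δ j i := by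
  have h : ∀ᶠ d in 𝓝[>] (0 : ℝ), ∀ j i, 0 < δ j i → d ≤ δ j i := by
    rw [eventually_all]
    intro j
    rw [eventually_all]
    intro i
    by_cases hp : 0 < δ j i
    · filter_upwards [Ioo_mem_nhdsGT hp] with d hd _ using hd.2.le
    · exact Eventually.of_forall fun d h => absurd h hp
  obtain ⟨d, hd, h0⟩ := (h.and self_mem_nhdsWithin).exists
  exact ⟨d, h0, hd⟩

/-- Outflows stay nonnegative. -/
theorem IsSolution.outflow_nonneg (h : IsSolution R δ lam c x z) {ε : ℝ} {v : E → ℝ}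
    (hv : IsContractionWeight R ε v) (hR : ∀ j i, 0 ≤ R j i) (hδ : ∀ j i, 0 ≤ δ j i)
    (hlam : ∀ i t, 0 ≤ lam i t) (hc : ∀ i t, 0 ≤ c i t)
    (hist : ∀ i, ∀ t, -maxDelay R δ ≤ t → t < 0 → 0 ≤ z i t) (i : E) {t : ℝ} (ht : 0 ≤ t) :
    0 ≤ z i t := by
  obtain ⟨d, hd, hdδ⟩ := exists_delay_lower_bound δ
  -- Method of steps: a positive delay leads back to an earlier slice of length `d` or to the
  -- history, where signs are known. Zero delays couple the links at the same instant, and there the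
  -- maximum principle is applied to the negative parts.
  have key : ∀ n : ℕ, ∀ t, 0 ≤ t → t < n * d → ∀ i, 0 ≤ z i t := by
    intro n
    induction n with
    | zero =>
      intro t ht htn
      simp only [Nat.cast_zero, zero_mul] at htn
      linarith
    | succ n ih =>
      intro t ht htn
      push_cast at htn
      suffices h0 : ∀ i, max (-z i t) 0 ≤ 0 from fun i => by
        have := (le_max_left _ _).trans (h0 i)
        linarith
      refine hv.nonpos_of_le_sum hR (e := fun i => max (-z i t) 0) fun i => ?_
      have hsum : ∀ j, R j i * -z j (t - δ j i) ≤ R j i * max (-z j t) 0 := fun j => by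
        rcases (hR j i).eq_or_lt with hR0 | hRpos
        · simp [← hR0]
        refine mul_le_mul_of_nonneg_left ?_ (hR j i)
        rcases (hδ j i).eq_or_lt with hδ0 | hδpos
        · rw [← hδ0, sub_zero]
          exact le_max_left _ _
        · have hdj := hdδ j i hδpos
          have hm := le_maxDelay (δ := δ) hRpos
          have : 0 ≤ z j (t - δ j i) := by
            rcases lt_or_ge (t - δ j i) 0 with hneg | hnn
            · exact hist j _ (by linarith) hneg
            · exact ih _ hnn (by linarith) j
          exact le_max_of_le_right (by linarith)
      have hnn : 0 ≤ ∑ j, R j i * max (-z j t) 0 :=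
        Finset.sum_nonneg fun j _ => mul_nonneg (hR j i) (le_max_right _ _)
      refine max_le ?_ hnn
      have hy : -inflow R δ lam z i t ≤ ∑ j, R j i * max (-z j t) 0 := by
        have h1 := Finset.sum_le_sum fun j (_ : j ∈ Finset.univ) => hsum j
        simp only [mul_neg, Finset.sum_neg_distrib] at h1
        simp only [inflow]
        linarith [hlam i t]
      rw [h.outflow i t ht]
      rcases (h.queue_nonneg i t ht).eq_or_lt with hx | hx
      · rw [linkOutflow_of_nonpos hx.ge]
        rcases min_choice (c i t) (inflow R δ lam z i t) with hm | hm <;> rw [hm]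
        · linarith [hc i t]
        · exact hy
      · rw [linkOutflow_of_pos hx]
        linarith [hc i t]
  obtain ⟨n, hn⟩ := exists_nat_gt (t / d)
  exact key n t ht ((div_lt_iff₀ hd).1 hn) i

/-- The outflows of bounded solutions, defined for all times, are determined by the queue
lengths. -/
theorem outflow_unique {ε : ℝ} {v : E → ℝ} (hv : IsContractionWeight R ε v)
    (hR : ∀ j i, 0 ≤ R j i) {z' : E → ℝ → ℝ} {C : E → ℝ} (hC : ∀ i t, |z i t - z' i t| ≤ C i)
    (hz : ∀ i t, z i t = linkOutflow (x i t) (inflow R δ lam z i t) (c i t))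
    (hz' : ∀ i t, z' i t = linkOutflow (x i t) (inflow R δ lam z' i t) (c i t)) : z = z' := by
  have hbdd : ∀ i, BddAbove (range fun t => |z i t - z' i t|) := fun i =>
    ⟨C i, by rintro _ ⟨t, rfl⟩; exact hC i t⟩
  -- Taking the supremum over all times removes the delays from the inequality, so the maximum
  -- principle applies.
  have h := hv.nonpos_of_le_sum hR (e := fun i => ⨆ t, |z i t - z' i t|) fun i => by
    refine ciSup_le fun t => ?_
    calc |z i t - z' i t| ≤ |inflow R δ lam z i t - inflow R δ lam z' i t| := by
          rw [hz i t, hz' i t]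
          exact abs_linkOutflow_sub_le
      _ ≤ ∑ j, R j i * |z j (t - δ j i) - z' j (t - δ j i)| := abs_inflow_sub_le hR i t
      _ ≤ _ := Finset.sum_le_sum fun j _ =>
          mul_le_mul_of_nonneg_left (le_ciSup (hbdd j) (t - δ j i)) (hR j i)
  funext i t
  have h1 := (le_ciSup (hbdd i) t).trans (h i)
  exact sub_eq_zero.1 (abs_nonpos_iff.1 h1)

/-- Attraction and periodicity force equal queues. The outflow law and the sign of the outflows,
known for nonnegative times, extend to all times by periodicity; with bounded capacities the
outflows are then bounded, hence determined by the queues at every instant. -/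
theorem IsPeriodicOrbit.eq_limit (N : IsStableNetwork T R lam c) {ε : ℝ} {v η : E → ℝ}
    (hv : IsContractionWeight R ε v) (hδ : ∀ j i, 0 ≤ δ j i) (hη : ∀ i, 0 < η i)
    (hc : ∀ i, ∃ C, ∀ t, c i t ≤ C) (h : IsPeriodicOrbit T R δ lam c η x z) :
    x = queueLimit T R δ lam c ∧ z = outflowLimit T R δ lam c := by
  obtain ⟨hs, hist⟩ := (isTrajectory_iff hv N.routing_nonneg hη).1 h.trajectory
  have hx : x = queueLimit T R δ lam c := by
    funext i t
    refine sub_eq_zero.1 (eq_zero_of_periodic_of_tendsto N.period_pos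
      (f := fun t => x i t - queueLimit T R δ lam c i t) (fun t => ?_)
      ((N.isGloballyAttractive_limit hv hδ hη x z h.trajectory).1 i) t)
    simp only [h.queue_periodic i t, N.periodic_queueLimit i t]
  refine ⟨hx, ?_⟩
  have hy := inflow_periodic (R := R) (δ := δ) N.lam_periodic h.outflow_periodic
  have hz : ∀ i t, z i t = linkOutflow (x i t) (inflow R δ lam z i t) (c i t) := by
    intro i t
    have hper : Function.Periodic
        (fun t => z i t - linkOutflow (x i t) (inflow R δ lam z i t) (c i t)) T := fun t => by
      simp only [h.outflow_periodic i t, h.queue_periodic i t, hy i t, N.cap_periodic i t]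
    obtain ⟨s, hs', hst⟩ := hper.exists_mem_Ico₀ N.period_pos t
    simp only [← hs.outflow i s hs'.1, sub_self] at hst
    exact sub_eq_zero.1 hst
  have hnn : ∀ i t, 0 ≤ z i t := by
    intro i t
    obtain ⟨s, hs', hst⟩ := (h.outflow_periodic i).exists_mem_Ico₀ N.period_pos t
    rw [hst]
    exact hs.outflow_nonneg hv N.routing_nonneg hδ N.lam_nonneg N.cap_nonneg hist i hs'.1
  choose C hC using hc
  refine outflow_unique hv N.routing_nonneg (C := C) (fun i t => ?_) hz fun i t => ?_
  · have h1 : z i t ≤ c i t := hz i t ▸ linkOutflow_le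
    have h2 := IsStableNetwork.outflowLimit_le (T := T) (R := R) (δ := δ) (lam := lam) (c := c) i t
    rw [abs_le]
    constructor <;> linarith [hnn i t, N.outflowLimit_nonneg (δ := δ) i t, hC i t]
  · rw [hx]
    exact N.outflowLimit_eq i t

end Uniqueness

end TrafficNetwork

/-! ### The main theorem -/

theorem mainTheorem7 {E : Type*} [Fintype E] (T : ℝ) (hT : 0 < T)
    (R : Matrix E E ℝ) (hR : TrafficNetwork.IsSubstochastic R)
    (δ : E → E → ℝ) (hδ : ∀ j i, 0 ≤ δ j i)
    (lam c : E → ℝ → ℝ)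
    (hlam_nonneg : ∀ i t, 0 ≤ lam i t) (hc_nonneg : ∀ i t, 0 ≤ c i t)
    (hlam_per : ∀ i, Function.Periodic (lam i) T) (hc_per : ∀ i, Function.Periodic (c i) T)
    (hlam_pc : ∀ i, TrafficNetwork.PiecewiseConstantOn T (lam i))
    (hc_pc : ∀ i, TrafficNetwork.PiecewiseConstantOn T (c i))
    (hstab : TrafficNetwork.StabilityCondition T R lam c)
    (η : E → ℝ) (hη : ∀ i, 0 < η i) :
    (∃! p : (ℕ → E → ℝ → ℝ) × (ℕ → E → ℝ → ℝ),
      TrafficNetwork.IsAlgorithmRun T R δ lam c p.1 p.2) ∧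
    ∀ x z : ℕ → E → ℝ → ℝ, TrafficNetwork.IsAlgorithmRun T R δ lam c x z →
      (∃ B : ℝ, ∀ k i t, 0 ≤ x k i t ∧ x k i t ≤ B) ∧
      (∀ k i t, 0 ≤ z k i t ∧ z k i t ≤ c i t) ∧
      (∀ k i t, x k i t ≤ x (k + 1) i t ∧ z k i t ≤ z (k + 1) i t) ∧
      ∃ xs zs : E → ℝ → ℝ,
        (∀ i, TendstoUniformly (fun k => x k i) (xs i) atTop) ∧
        (∀ i t, Tendsto (fun k => z k i t) atTop (𝓝 (zs i t))) ∧
        (∀ i, Tendsto (fun k => ∫ t in (0 : ℝ)..T, |z k i t - zs i t|) atTop (𝓝 0)) ∧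
        TrafficNetwork.IsPeriodicOrbit T R δ lam c η xs zs ∧
        (∀ x' z' : E → ℝ → ℝ, TrafficNetwork.IsPeriodicOrbit T R δ lam c η x' z' →
          x' = xs ∧ z' = zs) ∧
        TrafficNetwork.IsGloballyAttractive R δ lam c η xs zs := by
  obtain ⟨⟨ε, v, hv⟩, hstable⟩ := hstab.exists_weight hT hR.nonneg hlam_nonneg hc_nonneg
  have N : TrafficNetwork.IsStableNetwork T R lam c :=
    { period_pos := hT
      routing_nonneg := hR.nonneg
      lam_nonneg := hlam_nonneg
      cap_nonneg := hc_nonneg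
      lam_periodic := hlam_per
      cap_periodic := hc_per
      lam_step := fun i => (hlam_pc i).isStep hT (hlam_per i)
      cap_step := fun i => (hc_pc i).isStep hT (hc_per i)
      stable := hstable }
  refine ⟨⟨(_, _), N.isAlgorithmRun_iff.2 ⟨rfl, rfl⟩, fun p hp => ?_⟩, fun x z hxz => ?_⟩
  · obtain ⟨h1, h2⟩ := N.isAlgorithmRun_iff.1 hp
    exact Prod.ext h1 h2
  · obtain ⟨rfl, rfl⟩ := N.isAlgorithmRun_iff.1 hxz
    exact ⟨⟨_, fun k i t => ⟨N.queueIterate_nonneg k i t, N.queueIterate_le k i t⟩⟩,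
      fun k i t => ⟨N.outflowIterate_nonneg k i t,
        TrafficNetwork.IsStableNetwork.outflowIterate_le k i t⟩,
      fun k i t => ⟨N.queueIterate_le_succ k i t, N.outflowIterate_le_succ k i t⟩,
      _, _, N.tendstoUniformly_queueIterate, N.tendsto_outflowIterate,
      N.tendsto_integral_outflowIterate_sub, N.isPeriodicOrbit_limit hv hη,
      fun _ _ h => h.eq_limit N hv hδ hη fun i => (hc_pc i).exists_le hT (hc_per i),
      N.isGloballyAttractive_limit hv hδ hη⟩
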